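/- **Setting.** There are $m$ agents; agent $i$ has a finite non-empty set $\mathcal A_i$ of individual arms. There are $\rho$ groups $G_1,\dots,G_\rho\subseteq\{1,\dots,m\}$, which may overlap. A joint arm is $a\in\prod_{i=1}^m\mathcal A_i$; its local arm for group $e$ is the restriction $a^e\in\mathcal A^e=\prod_{i\in G_e}\mathcal A_i$, and $A_{\mathrm{loc}}=\sum_{e=1}^\rho|\mathcal A^e|$ is the number of local arms. Each local arm $a^e$ has an unknown reward law with mean $\mu_{a^e}$. When the joint arm $a$ is played, independent local rewards $f^e(a^e)$, $e=1,\dots,\rho$, are drawn from the laws of its local arms and observed, and the global reward is $f(a)=\sum_e f^e(a^e)$, with mean $\mu_a=\sum_e\mu_{a^e}$. All local rewards are subgaussian in the sense that $\mathbb P(|f^e(a^e)|\ge x)\le 2e^{-x^2/\sigma^2}$ for all $x\ge0$, where $\sigma>0$ is a constant ($\sigma=1$ is the $1$-subgaussian case). Let $\mathbf 1$ denote an optimal joint arm, i.e. $\mu_{\mathbf 1}=\max_a\mu_a$. Put $\Delta_a=\mu_{\mathbf 1}-\mu_a$, $\Delta_{\max}=\max_a\Delta_a$, $\Delta_{\min}=\min_{a\ne\mathbf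 1}\Delta_a$, and, for a local arm $b\in\mathcal A^e$, $\Delta_b=\min\{\Delta_a: a^e=b\}$. The regret over $T\ge1$ rounds in which the joint arms $A_1,\dots,A_T$ are played is $R_T=\mathbb E\big[\sum_{t=1}^T(\mu_{\mathbf 1}-f(A_t))\big]$. **Algorithm ($\epsilon$-MATS with scaling parameter $c$, $0<\epsilon\le1$).** For each local arm $b$ let $n_b(t)$ be the number of times it was pulled before round $t$ and $\hat\mu_b(t)$ the average of the rewards it returned ($0$ if $n_b(t)=0$). In round $t$, independently for all local arms $b$, the estimate $\theta_b(t)$ is a sample of $\mathcal N\big(\hat\mu_b(t),\tfrac{c}{n_b(t)+1}\big)$ with probability $\epsilon$, and equals $\hat\mu_b(t)$ with probability $1-\epsilon$. The algorithm plays $A_t\in\arg\max_a\sum_{e=1}^\rho\theta_{a^e}(t)$ (ties broken arbitrarily). **Theorem.** Run $\epsilon$-MATS with $c=\log T$. 1. There is a constant $C_1>0$, universal except for dependence on $\sigma$ (so an absolute constant for $\sigma=1$), such that whenever the optimal joint arm $\mathbf 1$ is unique, $$R_T\le\frac{C_1(C_1/\epsilon)^\rho\rho^2\log^2(TA_{\mathrm{loc}})}{\Delta_{\min}}+C_1\sum_{e=1}^\rho\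 \sum_{b\in\mathcal A^e\setminus\{\mathbf 1^e\}}\frac{\rho^2\log^2(TA_{\mathrm{loc}})}{\Delta_b}+C_1\Delta_{\max}.$$ 2. There is a constant $C_2>0$, universal except for dependence on $\sigma$, such that, whether or not the optimal joint arm is unique, $$R_T\le C_2\Delta_{\max}+C_2\,\rho\sqrt{\big((C_2/\epsilon)^\rho+A_{\mathrm{loc}}\big)\,T\log^2(TA_{\mathrm{loc}})}.$$ For $\epsilon=1$ these are bounds for MATS itself. (When there is only one joint arm, or $\rho=0$, the regret is $0$ and terms with an empty minimum or undefined logarithm are read as $0$.) -/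

import Mathlib

open MeasureTheory ProbabilityTheory

noncomputable section

/-- A stochastic multi-agent bandit with `m` agents and `ρ` (possibly overlapping) groups.
Agent `i` has the individual arms `Fin (K i)`; group `e` consists of the agents in `group e`.
`reward e b` is the law of the stochastic reward `f^e(b)` of the local arm `b` of group `e`. -/
structure MAMAB (m ρ : ℕ) where
  K : Fin m → ℕ
  K_pos : ∀ i, 0 < K i
  group : Fin ρ → Finset (Fin m)
  reward : (e : Fin ρ) → ((i : {i // i ∈ group e}) → Fin (K i)) → Measure ℝ
  isProb : ∀ e b, IsProbabilityMeasure (reward e b)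

namespace MAMAB

variable {m ρ : ℕ} (B : MAMAB m ρ)

/-- Joint arms: one individual arm for every agent. -/
abbrev Joint : Type := (i : Fin m) → Fin (B.K i)

/-- Local arms of group `e`: one individual arm for every agent of the group. -/
abbrev LocalArm (e : Fin ρ) : Type := (i : {i // i ∈ B.group e}) → Fin (B.K i)

/-- All local arms, over all groups. -/
abbrev Loc : Type := (e : Fin ρ) × B.LocalArm e

/-- The local arm `a^e` of the joint arm `a` for the group `e`. -/
def proj (a : B.Joint) (e : Fin ρ) : B.LocalArm e := fun i => a i

/-- The total number of local arms, `∑ₑ |𝒜^e|`. -/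
def Aloc : ℕ := ∑ e : Fin ρ, Fintype.card (B.LocalArm e)

/-- Every local reward `f` satisfies `P(|f| ≥ x) ≤ 2 exp(-x²/σ²)` for all `x ≥ 0`. -/
def Subgaussian (σ : ℝ) : Prop :=
  ∀ (e : Fin ρ) (b : B.LocalArm e) (x : ℝ), 0 ≤ x →
    (B.reward e b).real {y | x ≤ |y|} ≤ 2 * Real.exp (-(x ^ 2 / σ ^ 2))

/-- Mean of a local reward. -/
def localMean (e : Fin ρ) (b : B.LocalArm e) : ℝ := ∫ y, y ∂(B.reward e b)

/-- Mean of the global reward of a joint arm. -/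
def mean (a : B.Joint) : ℝ := ∑ e : Fin ρ, B.localMean e (B.proj a e)

/-- The joint arm `o` is optimal. -/
def IsOptimal (o : B.Joint) : Prop := ∀ a : B.Joint, B.mean a ≤ B.mean o

/-- The gap `Δ_a` of the joint arm `a`, relative to the optimal joint arm `o`. -/
def gap (o a : B.Joint) : ℝ := B.mean o - B.mean a

/-- `Δ_max`, the largest gap of a joint arm. -/
def gapMax (o : B.Joint) : ℝ := ⨆ a : B.Joint, B.gap o a

/-- `Δ_min`, the smallest gap of a joint arm different from `o`. -/
def gapMin (o : B.Joint) : ℝ := ⨅ a : {a : B.Joint // a ≠ o}, B.gap o a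

/-- `Δ_{a^e}`, the smallest gap of a joint arm whose local arm for the group `e` is `b`. -/
def localGap (o : B.Joint) (e : Fin ρ) (b : B.LocalArm e) : ℝ :=
  ⨅ a : {a : B.Joint // B.proj a e = b}, B.gap o a

/-- What happens in one round: the estimates `θ` of all local arms, the joint arm played, and the
local rewards (one for every group) that are received. -/
abbrev Round : Type := (B.Loc → ℝ) × B.Joint × (Fin ρ → ℝ)

/-- The number of pulls of the local arm `l` in the first `t` rounds. -/
def count {t : ℕ} (h : Fin t → B.Round) (l : B.Loc) : ℕ :=
  (Finset.univ.filter fun s : Fin t => B.proj (h s).2.1 l.1 = l.2).card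

/-- The average reward of the local arm `l` in the first `t` rounds (`0` if it was not pulled). -/
def empMean {t : ℕ} (h : Fin t → B.Round) (l : B.Loc) : ℝ :=
  (∑ s ∈ Finset.univ.filter (fun s : Fin t => B.proj (h s).2.1 l.1 = l.2), (h s).2.2 l.1)
    / (B.count h l : ℝ)

/-- The law of the estimate of the local arm `l` after the history `h`: with probability `ε` a
sample of the Gaussian with mean `empMean` and variance `c / (count + 1)`, otherwise `empMean`. -/
def estimateLaw (c ε : ℝ) {t : ℕ} (h : Fin t → B.Round) (l : B.Loc) : Measure ℝ :=
  ε.toNNReal • gaussianReal (B.empMean h l) (c / ((B.count h l : ℝ) + 1)).toNNReal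
    + (1 - ε).toNNReal • Measure.dirac (B.empMean h l)

section Run

variable {Ω : Type*} [MeasurableSpace Ω]

/-- The history before round `t` (rounds are numbered from `0`). -/
def hist (θ : ℕ → Ω → B.Loc → ℝ) (A : ℕ → Ω → B.Joint) (X : ℕ → Ω → Fin ρ → ℝ)
    (t : ℕ) (ω : Ω) : Fin t → B.Round :=
  fun s => (θ s ω, A s ω, X s ω)

/-- The processes `θ` (estimates), `A` (joint arms played) and `X` (local rewards received) on the
probability space `(Ω, P)` are a run of `ε`-exploring multi-agent Thompson sampling with scaling
parameter `c` over `T` rounds. Ties in the maximization may be broken in any way. -/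
structure IsRun (P : Measure Ω) [IsProbabilityMeasure P] (c ε : ℝ) (T : ℕ)
    (θ : ℕ → Ω → B.Loc → ℝ) (A : ℕ → Ω → B.Joint) (X : ℕ → Ω → Fin ρ → ℝ) : Prop where
  measurable_estimate : ∀ t < T, Measurable (θ t)
  measurable_arm : ∀ t < T, Measurable (A t)
  measurable_reward : ∀ t < T, Measurable (X t)
  /-- Given the history, the estimates of the local arms are independent, with law
  `estimateLaw`. -/
  estimate : ∀ t < T, ∀ᵐ h ∂(P.map (B.hist θ A X t)),
    condDistrib (θ t) (B.hist θ A X t) P h = Measure.pi (fun l => B.estimateLaw c ε h l)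
  /-- The joint arm maximizes the sum of the estimates of its local arms. -/
  argmax : ∀ t < T, ∀ᵐ ω ∂P, ∀ a : B.Joint,
    ∑ e : Fin ρ, θ t ω ⟨e, B.proj a e⟩ ≤ ∑ e : Fin ρ, θ t ω ⟨e, B.proj (A t ω) e⟩
  /-- Given the history, the estimates and the joint arm played, the local rewards are
  independent, each with the reward law of the local arm that is pulled. -/
  observe : ∀ t < T, ∀ᵐ p ∂(P.map fun ω => (B.hist θ A X t ω, θ t ω, A t ω)),
    condDistrib (X t) (fun ω => (B.hist θ A X t ω, θ t ω, A t ω)) P p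
      = Measure.pi (fun e => B.reward e (B.proj p.2.2 e))

/-- The regret `𝔼[∑ₜ (μ_o - f(A_t))]` over `T` rounds, relative to the optimal joint arm `o`; the
global reward of a round is the sum of its local rewards. -/
def regret (P : Measure Ω) (o : B.Joint) (T : ℕ) (X : ℕ → Ω → Fin ρ → ℝ) : ℝ :=
  ∫ ω, ∑ t ∈ Finset.range T, (B.mean o - ∑ e : Fin ρ, X t ω e) ∂P

end Run

end MAMAB

end

/-! The regret is the sum of the expected gaps of the joint arms played, and every gap is charged to
the pull of a local arm whose count is still small.

Concentration: the tail assumption yields a subgaussian bound for centred rewards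
(`lintegral_exp_centered_le_one`), hence an exponential supermartingale for the deviation of each
local arm. Markov's inequality and a union over the possible counts control the empirical means.
Outside an event of probability `O(1/T)` per round, each estimate is within `W / √(n + 1)` of its
mean, with `W` of order `log (T * Aloc)` and `n` the count.

Charging (`ofReal_gap_le_of_argmax`): let `α` be played in a good round. If its gap is at most twice
the sum of the radii of its non-optimal local arms, one of these has radius at least `gap / (2ρ)`;
over all its pulls such radii add up to `O(ρ² W² / Δ)`. Otherwise `α` wins only because optimal
local arms are underestimated. Let `V` be the groups where `α` deviates from `o` and the optimal
local arm has radius at least `gap / (4ρ)`. That `α` beats every joint arm avoiding `o` throughout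
`V` does not involve the estimates of the optimal local arms of `V` (`Blocks.of_agree`).

Optimism (`pow_mul_lintegral_goodBlockedGap_le`): given a good history, those estimates are
independent of the blocking event and all exceed their means with probability at least `(ε p)^|V|`,
where `p` is a Gaussian tail depending only on `σ`. When they do, the arm played must use one of the
optimal local arms of `V` (`Blocks.exists_pull`), whose radius is large. So the blocked gap costs at
most `(ε p)^(-ρ)` times the truncated radii of pulled optimal local arms. There are only `ρ` of
these, so the exponential factor never multiplies `Aloc`.

The first bound discards no positive gap; the second ignores gaps below a threshold `δ` and
optimizes `δ`. -/

/-! ### Exponential moments of rewards with Gaussian tails -/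

/-- A probability measure with tails `P(|y| ≥ x) ≤ 2 exp(-x²/σ²)` satisfies
`E exp(y²/(2σ²)) ≤ 3`. -/
theorem lintegral_exp_sq_le_three (ν : Measure ℝ) [IsProbabilityMeasure ν] {σ : ℝ} (hσ : 0 < σ)
    (h : ∀ x : ℝ, 0 ≤ x → ν.real {y | x ≤ |y|} ≤ 2 * Real.exp (-(x ^ 2 / σ ^ 2))) :
    ∫⁻ y, ENNReal.ofReal (Real.exp (y ^ 2 / (2 * σ ^ 2))) ∂ν ≤ 3 := by
  -- The event is `|y| ≥ √(2σ² log t)`, of probability at most `2 exp(-2 log t)`. In the layer-cake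
  -- formula, levels up to 1 contribute at most 1 and the levels above 1 at most `∫ 2 t⁻² = 2`.
  have tail : ∀ t : ℝ, 1 < t →
      ν {y | t ≤ Real.exp (y ^ 2 / (2 * σ ^ 2))} ≤ ENNReal.ofReal (2 * t ^ (-2 : ℝ)) := by
    intro t ht
    have hlog : 0 < Real.log t := Real.log_pos ht
    have hsub : {y : ℝ | t ≤ Real.exp (y ^ 2 / (2 * σ ^ 2))} ⊆
        {y | Real.sqrt (2 * σ ^ 2 * Real.log t) ≤ |y|} := by
      intro y hy
      have h1 : Real.log t ≤ y ^ 2 / (2 * σ ^ 2) :=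
        (Real.log_le_iff_le_exp (by linarith)).2 hy
      rw [le_div_iff₀ (by positivity)] at h1
      show Real.sqrt _ ≤ |y|
      rw [← Real.sqrt_sq_eq_abs]
      exact Real.sqrt_le_sqrt (by linarith)
    refine (measure_mono hsub).trans ?_
    rw [← ENNReal.ofReal_toReal (measure_ne_top ν _)]
    refine ENNReal.ofReal_le_ofReal ((h _ (Real.sqrt_nonneg _)).trans_eq ?_)
    rw [Real.sq_sqrt (by positivity), Real.rpow_def_of_pos (by linarith)]
    congr 2
    field_simp
  rw [lintegral_eq_lintegral_meas_le ν (Filter.Eventually.of_forall fun y => (Real.exp_pos _).le)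
    (by fun_prop)]
  rw [← Set.Ioc_union_Ioi_eq_Ioi (zero_le_one (α := ℝ)),
    lintegral_union measurableSet_Ioi (Set.Ioc_disjoint_Ioi le_rfl)]
  have h1 : ∫⁻ t in Set.Ioc (0 : ℝ) 1, ν {y | t ≤ Real.exp (y ^ 2 / (2 * σ ^ 2))} ≤ 1 := by
    calc _ ≤ ∫⁻ t in Set.Ioc (0 : ℝ) 1, 1 := lintegral_mono fun t => prob_le_one
      _ = 1 := by simp
  have h2 : ∫⁻ t in Set.Ioi (1 : ℝ), ν {y | t ≤ Real.exp (y ^ 2 / (2 * σ ^ 2))} ≤ 2 := by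
    calc _ ≤ ∫⁻ t in Set.Ioi (1 : ℝ), ENNReal.ofReal (2 * t ^ (-2 : ℝ)) :=
          setLIntegral_mono' measurableSet_Ioi fun t ht => tail t ht
      _ = ENNReal.ofReal (∫ t in Set.Ioi (1 : ℝ), 2 * t ^ (-2 : ℝ)) := by
          rw [ofReal_integral_eq_lintegral_ofReal]
          · exact ((integrableOn_Ioi_rpow_of_lt (by norm_num) one_pos).const_mul 2)
          · filter_upwards [ae_restrict_mem measurableSet_Ioi] with t ht
            have : (0 : ℝ) < t := lt_trans one_pos ht
            positivity
      _ = 2 := by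
          rw [integral_const_mul, integral_Ioi_rpow_of_lt (by norm_num) one_pos]
          norm_num
  calc _ ≤ (1 : ENNReal) + 2 := add_le_add h1 h2
    _ = 3 := by norm_num

theorem integrable_exp_sq (ν : Measure ℝ) [IsProbabilityMeasure ν] {σ : ℝ} (hσ : 0 < σ)
    (h : ∀ x : ℝ, 0 ≤ x → ν.real {y | x ≤ |y|} ≤ 2 * Real.exp (-(x ^ 2 / σ ^ 2))) :
    Integrable (fun y => Real.exp (y ^ 2 / (2 * σ ^ 2))) ν := by
  refine ⟨by fun_prop, ?_⟩
  rw [hasFiniteIntegral_iff_ofReal (Filter.Eventually.of_forall fun y => (Real.exp_pos _).le)]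
  exact (lintegral_exp_sq_le_three ν hσ h).trans_lt (by norm_num)

theorem integral_exp_sq_le_three (ν : Measure ℝ) [IsProbabilityMeasure ν] {σ : ℝ} (hσ : 0 < σ)
    (h : ∀ x : ℝ, 0 ≤ x → ν.real {y | x ≤ |y|} ≤ 2 * Real.exp (-(x ^ 2 / σ ^ 2))) :
    ∫ y, Real.exp (y ^ 2 / (2 * σ ^ 2)) ∂ν ≤ 3 := by
  rw [integral_eq_lintegral_of_nonneg_ae (Filter.Eventually.of_forall fun y => (Real.exp_pos _).le)
    (by fun_prop)]
  exact ENNReal.toReal_le_of_le_ofReal (by norm_num)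
    (by simpa using lintegral_exp_sq_le_three ν hσ h)

theorem abs_le_mul_exp_sq {σ : ℝ} (hσ : 0 < σ) (y : ℝ) :
    |y| ≤ σ * Real.exp (y ^ 2 / (2 * σ ^ 2)) := by
  have h1 := Real.add_one_le_exp (y ^ 2 / (2 * σ ^ 2))
  have h2 : |y| / σ ≤ y ^ 2 / (2 * σ ^ 2) + 1 := by
    have : y ^ 2 / (2 * σ ^ 2) = (|y| / σ) ^ 2 / 2 := by
      rw [div_pow, sq_abs]; field_simp
    rw [this]
    nlinarith [sq_nonneg (|y| / σ - 1)]
  have h3 := (div_le_iff₀ hσ).1 (h2.trans h1)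
  linarith

theorem integrable_id_of_tail (ν : Measure ℝ) [IsProbabilityMeasure ν] {σ : ℝ} (hσ : 0 < σ)
    (h : ∀ x : ℝ, 0 ≤ x → ν.real {y | x ≤ |y|} ≤ 2 * Real.exp (-(x ^ 2 / σ ^ 2))) :
    Integrable (fun y => y) ν :=
  ((integrable_exp_sq ν hσ h).const_mul σ).mono' (by fun_prop)
    (Filter.Eventually.of_forall fun y => abs_le_mul_exp_sq hσ y)

theorem integral_abs_le_of_tail (ν : Measure ℝ) [IsProbabilityMeasure ν] {σ : ℝ} (hσ : 0 < σ)
    (h : ∀ x : ℝ, 0 ≤ x → ν.real {y | x ≤ |y|} ≤ 2 * Real.exp (-(x ^ 2 / σ ^ 2))) :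
    ∫ y, |y| ∂ν ≤ 3 * σ := by
  calc ∫ y, |y| ∂ν ≤ ∫ y, σ * Real.exp (y ^ 2 / (2 * σ ^ 2)) ∂ν :=
        integral_mono (integrable_id_of_tail ν hσ h).abs ((integrable_exp_sq ν hσ h).const_mul σ)
          fun y => abs_le_mul_exp_sq hσ y
    _ = σ * ∫ y, Real.exp (y ^ 2 / (2 * σ ^ 2)) ∂ν := integral_const_mul _ _
    _ ≤ σ * 3 := by gcongr; exact integral_exp_sq_le_three ν hσ h
    _ = 3 * σ := mul_comm _ _

theorem abs_integral_le_of_tail (ν : Measure ℝ) [IsProbabilityMeasure ν] {σ : ℝ} (hσ : 0 < σ)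
    (h : ∀ x : ℝ, 0 ≤ x → ν.real {y | x ≤ |y|} ≤ 2 * Real.exp (-(x ^ 2 / σ ^ 2))) :
    |∫ y, y ∂ν| ≤ 3 * σ :=
  (abs_integral_le_integral_abs).trans (integral_abs_le_of_tail ν hσ h)

/-- Serves to bound exponential moments of centred variables: the linear term integrates to zero and
only the square remains in the exponent. -/
theorem Real.exp_le_add_exp_sq (y : ℝ) : Real.exp y ≤ y + Real.exp (y ^ 2) := by
  rcases le_or_gt |y| 1 with hy | hy
  · have h1 := Real.abs_exp_sub_one_sub_id_le hy
    have h2 := Real.add_one_le_exp (y ^ 2)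
    have h3 := (abs_le.1 h1).2
    linarith
  · rcases lt_or_ge 0 y with h0 | h0
    · rw [abs_of_pos h0] at hy
      have : Real.exp y ≤ Real.exp (y ^ 2) := Real.exp_le_exp.2 (by nlinarith)
      linarith
    · rw [abs_of_nonpos h0] at hy
      have h1 : Real.exp y ≤ 1 := Real.exp_le_one_iff.2 h0
      have h2 := Real.add_one_le_exp (y ^ 2)
      nlinarith

theorem Real.exp_mul_le_of_mem_Icc {s u : ℝ} (hs : 0 ≤ s) (hs1 : s ≤ 1) :
    Real.exp (s * u) ≤ 1 - s + s * Real.exp u := by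
  have := convexOn_exp.2 (Set.mem_univ (0 : ℝ)) (Set.mem_univ u) (sub_nonneg.2 hs1) hs (by ring)
  simpa using this

/-- The variance proxy of a centred reward whose tails have the parameter `σ`. -/
noncomputable def varianceProxy (σ : ℝ) : ℝ := 12 * σ ^ 2 * Real.exp 9

theorem varianceProxy_pos {σ : ℝ} (hσ : 0 < σ) : 0 < varianceProxy σ := by
  unfold varianceProxy; positivity

/-- With `c = 4σ²` and `M = 3e⁹`, the square-exponential moment of `(y - m)/√c` is at most `M`. For
`s² c ≤ 1`, `Real.exp_le_add_exp_sq` removes the linear term and convexity extracts the factor `s²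
c`. For larger `s`, Young's inequality `s u ≤ s² c / 4 + u² / c` is enough, since the constant `M`
is absorbed by `s² c > 1`. The form "at most one" is that of a supermartingale factor. -/
theorem lintegral_exp_centered_le_one (ν : Measure ℝ) [IsProbabilityMeasure ν] {σ : ℝ}
    (hσ : 0 < σ)
    (h : ∀ x : ℝ, 0 ≤ x → ν.real {y | x ≤ |y|} ≤ 2 * Real.exp (-(x ^ 2 / σ ^ 2))) (s : ℝ) :
    ∫⁻ y, ENNReal.ofReal (Real.exp (s * (y - ∫ z, z ∂ν) - varianceProxy σ * s ^ 2)) ∂ν ≤ 1 := by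
  set m := ∫ z, z ∂ν with hm
  have hmle : |m| ≤ 3 * σ := abs_integral_le_of_tail ν hσ h
  have hE := integrable_exp_sq ν hσ h
  have hX := integrable_id_of_tail ν hσ h
  set c := 4 * σ ^ 2 with hc
  have hcpos : 0 < c := by positivity
  set M := 3 * Real.exp 9 with hM
  have hvp : varianceProxy σ = c * M := by unfold varianceProxy; rw [hc, hM]; ring
  -- From `(y - m)² ≤ 2y² + 2m²` and `|m| ≤ 3σ`; the mean contributes at most 9/2 to the exponent,
  -- so 9 leaves room.
  have hpt : ∀ y, Real.exp ((y - m) ^ 2 / c) ≤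
      Real.exp 9 * Real.exp (y ^ 2 / (2 * σ ^ 2)) := by
    intro y
    rw [← Real.exp_add]
    refine Real.exp_le_exp.2 ?_
    have hm2 : m ^ 2 ≤ 9 * σ ^ 2 := by
      have := pow_le_pow_left₀ (abs_nonneg m) hmle 2
      rw [sq_abs] at this; linarith
    have h9 : (9 : ℝ) + y ^ 2 / (2 * σ ^ 2) = (36 * σ ^ 2 + 2 * y ^ 2) / c := by
      rw [hc]; field_simp; ring
    rw [h9]
    gcongr
    nlinarith [sq_nonneg (y + m), sq_nonneg σ]
  have hF : Integrable (fun y => Real.exp ((y - m) ^ 2 / c)) ν :=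
    (hE.const_mul (Real.exp 9)).mono' (by fun_prop)
      (Filter.Eventually.of_forall fun y => by
        rw [Real.norm_of_nonneg (Real.exp_pos _).le]; exact hpt y)
  have hFle : ∫ y, Real.exp ((y - m) ^ 2 / c) ∂ν ≤ M := by
    calc _ ≤ ∫ y, Real.exp 9 * Real.exp (y ^ 2 / (2 * σ ^ 2)) ∂ν :=
          integral_mono hF (hE.const_mul _) hpt
      _ = Real.exp 9 * ∫ y, Real.exp (y ^ 2 / (2 * σ ^ 2)) ∂ν := integral_const_mul _ _
      _ ≤ Real.exp 9 * 3 := by gcongr; exact integral_exp_sq_le_three ν hσ h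
      _ = M := by rw [hM]; ring
  have hM1 : 1 ≤ M := by
    have := Real.add_one_le_exp (9 : ℝ); rw [hM]; linarith
  -- an integrable majorant whose integral is small enough
  have key : ∃ g : ℝ → ℝ, Integrable g ν ∧ (∀ y, Real.exp (s * (y - m)) ≤ g y) ∧
      ∫ y, g y ∂ν ≤ Real.exp (varianceProxy σ * s ^ 2) := by
    rcases le_or_gt (s ^ 2 * c) 1 with hs | hs
    · refine ⟨fun y => s * (y - m) + (1 - s ^ 2 * c + s ^ 2 * c * Real.exp ((y - m) ^ 2 / c)),
        ?_, fun y => ?_, ?_⟩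
      · exact ((hX.sub (integrable_const m)).const_mul s).add
          ((integrable_const _).add (hF.const_mul _))
      · refine (Real.exp_le_add_exp_sq _).trans ?_
        have := Real.exp_mul_le_of_mem_Icc (u := (y - m) ^ 2 / c) (by positivity) hs
        have e : s ^ 2 * c * ((y - m) ^ 2 / c) = (s * (y - m)) ^ 2 := by field_simp
        rw [e] at this
        linarith
      · have i1 : Integrable (fun y => s * (y - m)) ν := (hX.sub (integrable_const m)).const_mul s
        have i2 : Integrable (fun y => s ^ 2 * c * Real.exp ((y - m) ^ 2 / c)) ν := hF.const_mul _
        have i3 : Integrable (fun y => 1 - s ^ 2 * c + s ^ 2 * c * Real.exp ((y - m) ^ 2 / c)) ν :=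
          (integrable_const _).add i2
        rw [integral_add i1 i3, integral_add (integrable_const _) i2, integral_const_mul,
          integral_const_mul, integral_sub hX (integrable_const _)]
        simp only [integral_const, probReal_univ, smul_eq_mul, one_mul, ← hm, sub_self, mul_zero,
          zero_add]
        calc 1 - s ^ 2 * c + s ^ 2 * c * ∫ y, Real.exp ((y - m) ^ 2 / c) ∂ν
            ≤ 1 - s ^ 2 * c + s ^ 2 * c * M := by gcongr
          _ ≤ varianceProxy σ * s ^ 2 + 1 := by rw [hvp]; nlinarith [sq_nonneg s]
          _ ≤ _ := Real.add_one_le_exp _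
    · refine ⟨fun y => Real.exp (s ^ 2 * c / 4) * Real.exp ((y - m) ^ 2 / c), hF.const_mul _,
        fun y => ?_, ?_⟩
      · dsimp only
        rw [← Real.exp_add]
        refine Real.exp_le_exp.2 ?_
        have : s ^ 2 * c / 4 + (y - m) ^ 2 / c - s * (y - m)
            = (s * c / 2 - (y - m)) ^ 2 / c := by field_simp; ring
        have h0 : 0 ≤ (s * c / 2 - (y - m)) ^ 2 / c := by positivity
        linarith
      · rw [integral_const_mul]
        calc _ ≤ Real.exp (s ^ 2 * c / 4) * M := by gcongr
          _ ≤ Real.exp (s ^ 2 * c / 4) * Real.exp (M - 1) := by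
              gcongr
              have := Real.add_one_le_exp (M - 1); linarith
          _ = Real.exp (s ^ 2 * c / 4 + (M - 1)) := (Real.exp_add _ _).symm
          _ ≤ _ := Real.exp_le_exp.2 (by rw [hvp]; nlinarith)
  obtain ⟨g, hg, hle, hint⟩ := key
  have hg0 : ∀ y, 0 ≤ g y := fun y => (Real.exp_pos _).le.trans (hle y)
  calc _ ≤ ∫⁻ y, ENNReal.ofReal (Real.exp (-(varianceProxy σ * s ^ 2)) * g y) ∂ν := by
        refine lintegral_mono fun y => ENNReal.ofReal_le_ofReal ?_
        rw [sub_eq_add_neg, Real.exp_add, mul_comm]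
        gcongr
        exact hle y
    _ = ENNReal.ofReal (∫ y, Real.exp (-(varianceProxy σ * s ^ 2)) * g y ∂ν) := by
        rw [ofReal_integral_eq_lintegral_ofReal (hg.const_mul _)]
        exact Filter.Eventually.of_forall fun y => mul_nonneg (Real.exp_pos _).le (hg0 y)
    _ ≤ ENNReal.ofReal 1 := by
        refine ENNReal.ofReal_le_ofReal ?_
        rw [integral_const_mul, Real.exp_neg, inv_mul_le_iff₀ (Real.exp_pos _), mul_one]
        exact hint
    _ = 1 := ENNReal.ofReal_one

/-! ### Gaussian tails from above and from below -/

theorem hasSubgaussianMGF_gaussianReal (v : NNReal) :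
    HasSubgaussianMGF id v (gaussianReal 0 v) where
  integrable_exp_mul t := integrable_exp_mul_gaussianReal t
  mgf_le t := by rw [mgf_id_gaussianReal]; simp

/-- The strict inequality makes the bound valid for `v = 0`, where the law is a Dirac mass at `m`.
-/
theorem gaussianReal_tail_le (m : ℝ) (v : NNReal) {r : ℝ} (hr : 0 ≤ r) :
    gaussianReal m v {y | Real.sqrt (2 * v * r) < |y - m|} ≤
      ENNReal.ofReal (2 * Real.exp (-r)) := by
  by_cases hv : v = 0
  · subst hv
    rw [gaussianReal_zero_var, Measure.dirac_apply' _
      (measurableSet_lt measurable_const (by fun_prop))]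
    simp
  have hv0 : (0 : ℝ) < v := by positivity
  set a := Real.sqrt (2 * v * r) with ha
  have ha0 : 0 ≤ a := Real.sqrt_nonneg _
  have e : -a ^ 2 / (2 * (v : ℝ)) = -r := by
    rw [ha, Real.sq_sqrt (by positivity)]; field_simp
  have hmap : gaussianReal m v = (gaussianReal 0 v).map (fun x => m + x) := by
    rw [gaussianReal_map_const_add]; simp
  rw [hmap, Measure.map_apply (by fun_prop) (measurableSet_lt measurable_const (by fun_prop))]
  have hsub : (fun x => m + x) ⁻¹' {y : ℝ | a < |y - m|} ⊆
      {x : ℝ | a ≤ id x} ∪ {x : ℝ | a ≤ (-id) x} := by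
    intro x hx
    have hx' : a < |x| := by simpa using hx
    rcases lt_abs.1 hx' with h | h
    · exact Or.inl h.le
    · exact Or.inr h.le
  have h1 := (hasSubgaussianMGF_gaussianReal v).measure_ge_le ha0
  have h2 := (hasSubgaussianMGF_gaussianReal v).neg.measure_ge_le ha0
  rw [e] at h1 h2
  refine (measure_mono hsub).trans ((measure_union_le _ _).trans ?_)
  rw [two_mul, ENNReal.ofReal_add (Real.exp_pos _).le (Real.exp_pos _).le]
  refine add_le_add ?_ ?_
  · rw [← ENNReal.ofReal_toReal (measure_ne_top (gaussianReal 0 v) _)]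
    exact ENNReal.ofReal_le_ofReal h1
  · rw [← ENNReal.ofReal_toReal (measure_ne_top (gaussianReal 0 v) _)]
    exact ENNReal.ofReal_le_ofReal h2

/-- By scaling, a threshold at most `z` standard deviations above the mean is exceeded with a
probability bounded below independently of mean and variance. -/
theorem gaussianReal_Ici_le (m z : ℝ) {v c : ℝ} (hv : 0 < v) (hc : c ≤ m + z * Real.sqrt v) :
    gaussianReal 0 1 (Set.Ici z) ≤ gaussianReal m v.toNNReal (Set.Ici c) := by
  have hs : 0 < Real.sqrt v := Real.sqrt_pos.2 hv
  have hmap : gaussianReal m v.toNNReal =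
      (gaussianReal 0 1).map (fun x => m + Real.sqrt v * x) := by
    have : (fun x => m + Real.sqrt v * x) = (fun x => m + x) ∘ (fun x => Real.sqrt v * x) := rfl
    rw [this, ← Measure.map_map (by fun_prop) (by fun_prop), gaussianReal_map_const_mul,
      gaussianReal_map_const_add]
    congr 1
    · simp
    · ext; simp [Real.sq_sqrt hv.le, hv.le]
  rw [hmap, Measure.map_apply (by fun_prop) measurableSet_Ici]
  refine measure_mono fun x hx => ?_
  have hx' : z ≤ x := hx
  show c ≤ m + Real.sqrt v * x
  nlinarith

theorem gaussianReal_Ici_pos (z : ℝ) : 0 < gaussianReal 0 1 (Set.Ici z) := by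
  rw [pos_iff_ne_zero]
  intro h
  have := gaussianReal_absolutelyContinuous' 0 (one_ne_zero (α := NNReal)) h
  simp at this

/-! ### Independence of coordinates -/

/-- Under a product measure, a function that ignores the coordinates in `S` is independent of the
event that all coordinates in `S` are large. -/
theorem lintegral_le_of_ignores {ι : Type*} [Fintype ι] [DecidableEq ι] (ν : ι → Measure ℝ)
    [∀ i, IsProbabilityMeasure (ν i)] (S : Finset ι) (c : ι → ℝ) (q : ENNReal)
    (hq : ∀ i ∈ S, q ≤ ν i (Set.Ici (c i))) (D : (ι → ℝ) → ENNReal) (hD : Measurable D)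
    (hign : ∀ x y : ι → ℝ, (∀ i ∉ S, x i = y i) → D x = D y) :
    q ^ S.card * ∫⁻ x, D x ∂(Measure.pi ν) ≤
      ∫⁻ x, {x : ι → ℝ | ∀ i ∈ S, c i ≤ x i}.indicator D x ∂(Measure.pi ν) := by
  have hind : iIndepFun (fun i (x : ι → ℝ) => x i) (Measure.pi ν) :=
    iIndepFun_pi (X := fun _ => id) fun _ => aemeasurable_id
  have hfin := hind.indepFun_finset S Sᶜ disjoint_compl_right fun i => measurable_pi_apply i
  let F : (S → ℝ) → ENNReal := fun y => {y : S → ℝ | ∀ i : S, c i ≤ y i}.indicator 1 y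
  -- The coordinates in `S` are filled with zeros, which is harmless as `D` ignores them.
  let D' : ((Sᶜ : Finset ι) → ℝ) → ENNReal := fun y =>
    D fun i => if h : i ∈ Sᶜ then y ⟨i, h⟩ else 0
  have hFset : MeasurableSet {y : S → ℝ | ∀ i : S, c i ≤ y i} := by
    rw [Set.ofPred_forall]
    exact MeasurableSet.iInter fun i => measurableSet_le measurable_const (measurable_pi_apply i)
  have hF : Measurable F := measurable_one.indicator hFset
  have hD' : Measurable D' := by
    refine hD.comp (measurable_pi_lambda _ fun i => ?_)
    by_cases h : i ∈ Sᶜ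
    · simp only [h, dite_true]; exact measurable_pi_apply _
    · simp only [h, dite_false]; exact measurable_const
  have hDD : ∀ x, D x = D' (fun i : (Sᶜ : Finset ι) => x i) := fun x =>
    hign _ _ fun i hi => by simp [hi]
  have hmul : ∀ x : ι → ℝ, {x : ι → ℝ | ∀ i ∈ S, c i ≤ x i}.indicator D x =
      F (fun i : S => x i) * D' (fun i : (Sᶜ : Finset ι) => x i) := by
    intro x
    rw [← hDD]
    by_cases hx : ∀ i ∈ S, c i ≤ x i
    · rw [Set.indicator_of_mem (show x ∈ {x : ι → ℝ | ∀ i ∈ S, c i ≤ x i} from hx)]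
      have : F (fun i : S => x i) = 1 := 
        Set.indicator_of_mem (s := {y : S → ℝ | ∀ i : S, c i ≤ y i}) (fun i : S => hx i i.2) _
      rw [this, one_mul]
    · rw [Set.indicator_of_notMem (show x ∉ {x : ι → ℝ | ∀ i ∈ S, c i ≤ x i} from hx)]
      have : F (fun i : S => x i) = 0 :=
        Set.indicator_of_notMem (s := {y : S → ℝ | ∀ i : S, c i ≤ y i})
          (fun h => hx fun i hi => (show ∀ i : S, c i ≤ x i from h) ⟨i, hi⟩) _
      rw [this, zero_mul]
  have hcomp := hfin.comp hF hD'
  have mS : Measurable fun (x : ι → ℝ) (i : S) => x i :=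
    measurable_pi_lambda _ fun i => measurable_pi_apply _
  have mSc : Measurable fun (x : ι → ℝ) (i : (Sᶜ : Finset ι)) => x i :=
    measurable_pi_lambda _ fun i => measurable_pi_apply _
  have hprod := lintegral_mul_eq_lintegral_mul_lintegral_of_indepFun
    (hF.comp mS) (hD'.comp mSc) hcomp
  simp only [Pi.mul_apply, Function.comp_apply] at hprod
  simp_rw [hmul]
  rw [hprod]
  simp_rw [← hDD]
  gcongr
  have hset : {x : ι → ℝ | ∀ i ∈ S, c i ≤ x i} =
      Set.univ.pi fun i => if i ∈ S then Set.Ici (c i) else Set.univ := by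
    ext x
    simp only [Set.mem_ofPred_eq, Set.mem_univ_pi]
    refine forall_congr' fun i => ?_
    by_cases hi : i ∈ S <;> simp [hi]
  have hint : ∫⁻ x, F (fun i : S => x i) ∂(Measure.pi ν) =
      Measure.pi ν {x : ι → ℝ | ∀ i ∈ S, c i ≤ x i} := by
    rw [← lintegral_indicator_one (by
      rw [hset]
      refine MeasurableSet.univ_pi fun i => ?_
      split_ifs
      · exact measurableSet_Ici
      · exact MeasurableSet.univ)]
    refine lintegral_congr fun x => ?_
    simp only [F, Set.indicator_apply, Set.mem_ofPred_eq, Subtype.forall]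
    rfl
  rw [hint, hset, Measure.pi_pi]
  calc q ^ S.card = ∏ i ∈ S, q := by simp
    _ ≤ ∏ i ∈ S, ν i (Set.Ici (c i)) := Finset.prod_le_prod' hq
    _ = ∏ i ∈ S, ν i (if i ∈ S then Set.Ici (c i) else Set.univ) :=
        Finset.prod_congr rfl fun i hi => by simp [hi]
    _ = ∏ i, ν i (if i ∈ S then Set.Ici (c i) else Set.univ) :=
        Finset.prod_subset (Finset.subset_univ _) fun i _ hi => by simp [hi]
    _ ≤ _ := le_rfl

/-! ### Tails of the law of an estimate -/

namespace MAMAB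

variable {m ρ : ℕ} (B : MAMAB m ρ)

theorem isProbabilityMeasure_estimateLaw {c ε : ℝ} (hε : 0 ≤ ε) (hε1 : ε ≤ 1) {t : ℕ}
    (h : Fin t → B.Round) (l : B.Loc) : IsProbabilityMeasure (B.estimateLaw c ε h l) := by
  constructor
  simp only [estimateLaw, Measure.coe_add, Measure.coe_nnreal_smul_apply, Pi.add_apply,
    measure_univ, mul_one]
  rw [← ENNReal.coe_add, ← Real.toNNReal_add hε (by linarith)]
  simp

theorem estimateLaw_tail_le {c ε : ℝ} (hε1 : ε ≤ 1) (hc : 0 ≤ c) {t : ℕ}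
    (h : Fin t → B.Round) (l : B.Loc) {r : ℝ} (hr : 0 ≤ r) :
    B.estimateLaw c ε h l
      {y | Real.sqrt (2 * (c / ((B.count h l : ℝ) + 1)) * r) < |y - B.empMean h l|} ≤
      ENNReal.ofReal (2 * Real.exp (-r)) := by
  have hv : 0 ≤ c / ((B.count h l : ℝ) + 1) := by positivity
  have hg := gaussianReal_tail_le (B.empMean h l) (c / ((B.count h l : ℝ) + 1)).toNNReal hr
  rw [Real.coe_toNNReal _ hv] at hg
  simp only [estimateLaw, Measure.coe_add, Measure.coe_nnreal_smul_apply, Pi.add_apply]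
  rw [Measure.dirac_apply' _ (measurableSet_lt measurable_const (by fun_prop))]
  -- The atom sits at the empirical mean, at distance zero, and the strict inequality excludes it.
  have h0 : {y | Real.sqrt (2 * (c / ((B.count h l : ℝ) + 1)) * r) < |y - B.empMean h l|}.indicator
      (1 : ℝ → ENNReal) (B.empMean h l) = 0 := by
    simp [Real.sqrt_nonneg]
  rw [h0, mul_zero, add_zero]
  calc _ ≤ 1 * ENNReal.ofReal (2 * Real.exp (-r)) := by
        gcongr
        exact_mod_cast Real.toNNReal_le_one.2 hε1
    _ = _ := one_mul _

theorem le_estimateLaw_Ici {c ε z x : ℝ} (hc : 0 < c) {t : ℕ} (h : Fin t → B.Round)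
    (l : B.Loc) (hx : x ≤ B.empMean h l + z * Real.sqrt (c / ((B.count h l : ℝ) + 1))) :
    ENNReal.ofReal ε * gaussianReal 0 1 (Set.Ici z) ≤ B.estimateLaw c ε h l (Set.Ici x) := by
  have hv : 0 < c / ((B.count h l : ℝ) + 1) := by positivity
  simp only [estimateLaw, Measure.coe_add, Measure.coe_nnreal_smul_apply, Pi.add_apply]
  refine le_add_right ?_
  exact mul_le_mul_right (gaussianReal_Ici_le _ z hv hx) _

end MAMAB

/-! ### Integration through conditional laws -/

/-- The family `κ` need not be measurable: the disintegration uses the kernel `condDistrib`, and `κ`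
is substituted only at the end, almost everywhere. -/
theorem lintegral_eq_of_condDistrib {Ω β γ : Type*} [MeasurableSpace Ω] [MeasurableSpace β]
    [MeasurableSpace γ] [StandardBorelSpace γ] [Nonempty γ] {P : Measure Ω}
    [IsProbabilityMeasure P] {Y : Ω → β} {Z : Ω → γ} (hY : Measurable Y) (hZ : Measurable Z)
    {κ : β → Measure γ} (h : ∀ᵐ y ∂(P.map Y), condDistrib Z Y P y = κ y)
    {f : β × γ → ENNReal} (hf : Measurable f) :
    ∫⁻ ω, f (Y ω, Z ω) ∂P = ∫⁻ ω, ∫⁻ z, f (Y ω, z) ∂(κ (Y ω)) ∂P := by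
  rw [← lintegral_map (f := f) (g := fun ω => (Y ω, Z ω)) hf (hY.prodMk hZ),
    ← compProd_map_condDistrib hZ.aemeasurable, Measure.lintegral_compProd hf,
    lintegral_map (Measurable.lintegral_kernel_prod_right' hf) hY]
  refine lintegral_congr_ae ?_
  filter_upwards [ae_of_ae_map hY.aemeasurable h] with ω hω
  rw [hω]

theorem integral_eq_of_condDistrib {Ω β γ : Type*} [MeasurableSpace Ω] [MeasurableSpace β]
    [MeasurableSpace γ] [StandardBorelSpace γ] [Nonempty γ] {P : Measure Ω}
    [IsProbabilityMeasure P] {Y : Ω → β} {Z : Ω → γ} (hY : Measurable Y) (hZ : Measurable Z)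
    {κ : β → Measure γ} (h : ∀ᵐ y ∂(P.map Y), condDistrib Z Y P y = κ y)
    {f : γ → ℝ} (hf : StronglyMeasurable f) (hint : Integrable (fun ω => f (Z ω)) P) :
    ∫ ω, f (Z ω) ∂P = ∫ ω, ∫ z, f z ∂(κ (Y ω)) ∂P := by
  have hf2 : StronglyMeasurable fun p : β × γ => f p.2 := hf.comp_measurable measurable_snd
  have hint' : Integrable (fun p : β × γ => f p.2) (P.map fun ω => (Y ω, Z ω)) :=
    (integrable_map_measure hf2.aestronglyMeasurable (hY.prodMk hZ).aemeasurable).2 hint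
  have e1 : ∫ ω, f (Z ω) ∂P = ∫ p, f p.2 ∂(P.map fun ω => (Y ω, Z ω)) :=
    (integral_map (hY.prodMk hZ).aemeasurable hf2.aestronglyMeasurable).symm
  rw [e1, ← compProd_map_condDistrib hZ.aemeasurable] at *
  rw [Measure.integral_compProd hint', integral_map hY.aemeasurable]
  · refine integral_congr_ae ?_
    filter_upwards [ae_of_ae_map hY.aemeasurable h] with ω hω
    rw [hω]
  · exact (StronglyMeasurable.integral_kernel_prod_right' hf2).aestronglyMeasurable

/-! ### Histories, one-step conditioning and the regret as a sum of gaps -/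

namespace MAMAB

variable {m ρ : ℕ} (B : MAMAB m ρ)

instance (e : Fin ρ) (b : B.LocalArm e) : IsProbabilityMeasure (B.reward e b) := B.isProb e b

instance : Nonempty B.Joint := ⟨fun i => ⟨0, B.K_pos i⟩⟩

/-- The sum of the rewards of the local arm `l` in the first `t` rounds. -/
def rewardSum {t : ℕ} (h : Fin t → B.Round) (l : B.Loc) : ℝ :=
  ∑ s ∈ Finset.univ.filter (fun s : Fin t => B.proj (h s).2.1 l.1 = l.2), (h s).2.2 l.1

theorem empMean_eq {t : ℕ} (h : Fin t → B.Round) (l : B.Loc) :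
    B.empMean h l = B.rewardSum h l / (B.count h l : ℝ) := rfl

theorem measurable_count {t : ℕ} (l : B.Loc) :
    Measurable fun h : Fin t → B.Round => B.count h l := by
  have : (fun h : Fin t → B.Round => B.count h l) = fun h =>
      ∑ s : Fin t, if B.proj (h s).2.1 l.1 = l.2 then 1 else 0 := by
    funext h; exact Finset.card_filter _ _
  rw [this]
  refine Finset.measurable_fun_sum _ fun s _ => ?_
  have h1 : Measurable fun a : B.Joint => if B.proj a l.1 = l.2 then 1 else 0 := .of_discrete
  exact h1.comp (by fun_prop)

theorem measurable_rewardSum {t : ℕ} (l : B.Loc) :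
    Measurable fun h : Fin t → B.Round => B.rewardSum h l := by
  have : (fun h : Fin t → B.Round => B.rewardSum h l) = fun h =>
      ∑ s : Fin t, if B.proj (h s).2.1 l.1 = l.2 then (h s).2.2 l.1 else 0 := by
    funext h; exact Finset.sum_filter _ _
  rw [this]
  refine Finset.measurable_fun_sum _ fun s _ => ?_
  refine Measurable.ite ?_ (by fun_prop) measurable_const
  have h1 : MeasurableSet {a : B.Joint | B.proj a l.1 = l.2} := .of_discrete
  exact (show Measurable fun h : Fin t → B.Round => (h s).2.1 by fun_prop) h1

theorem measurable_empMean {t : ℕ} (l : B.Loc) :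
    Measurable fun h : Fin t → B.Round => B.empMean h l := by
  simp_rw [empMean_eq]
  exact (B.measurable_rewardSum l).div ((measurable_from_top (f := fun n : ℕ => (n : ℝ))).comp
    (B.measurable_count l))

variable {Ω : Type*} {θ : ℕ → Ω → B.Loc → ℝ} {A : ℕ → Ω → B.Joint} {X : ℕ → Ω → Fin ρ → ℝ}

theorem count_hist_zero (ω : Ω) (l : B.Loc) : B.count (B.hist θ A X 0 ω) l = 0 := by
  simp [count]

theorem rewardSum_hist_zero (ω : Ω) (l : B.Loc) : B.rewardSum (B.hist θ A X 0 ω) l = 0 := by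
  simp [rewardSum]

theorem count_hist_succ (t : ℕ) (ω : Ω) (l : B.Loc) :
    B.count (B.hist θ A X (t + 1) ω) l =
      B.count (B.hist θ A X t ω) l + if B.proj (A t ω) l.1 = l.2 then 1 else 0 := by
  unfold count
  rw [Finset.card_filter, Finset.card_filter, Fin.sum_univ_castSucc]
  rfl

theorem rewardSum_hist_succ (t : ℕ) (ω : Ω) (l : B.Loc) :
    B.rewardSum (B.hist θ A X (t + 1) ω) l =
      B.rewardSum (B.hist θ A X t ω) l + if B.proj (A t ω) l.1 = l.2 then X t ω l.1 else 0 := by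
  unfold rewardSum
  rw [Finset.sum_filter, Finset.sum_filter, Fin.sum_univ_castSucc]
  rfl

theorem count_hist_le (t : ℕ) (ω : Ω) (l : B.Loc) : B.count (B.hist θ A X t ω) l ≤ t :=
  (Finset.card_le_univ _).trans (by simp)

section Run

variable [MeasurableSpace Ω] {P : Measure Ω} [IsProbabilityMeasure P] {c ε : ℝ} {T : ℕ}

variable {B}

theorem IsRun.measurable_hist (hrun : B.IsRun P c ε T θ A X) {t : ℕ} (ht : t ≤ T) :
    Measurable (B.hist θ A X t) :=
  measurable_pi_lambda _ fun s =>
    (hrun.measurable_estimate s (s.2.trans_le ht)).prodMk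
      ((hrun.measurable_arm s (s.2.trans_le ht)).prodMk
        (hrun.measurable_reward s (s.2.trans_le ht)))

theorem IsRun.lintegral_estimate (hrun : B.IsRun P c ε T θ A X) {t : ℕ} (ht : t < T)
    {f : (Fin t → B.Round) × (B.Loc → ℝ) → ENNReal} (hf : Measurable f) :
    ∫⁻ ω, f (B.hist θ A X t ω, θ t ω) ∂P = ∫⁻ ω, ∫⁻ x, f (B.hist θ A X t ω, x)
      ∂(Measure.pi fun l => B.estimateLaw c ε (B.hist θ A X t ω) l) ∂P :=
  lintegral_eq_of_condDistrib (κ := fun h => Measure.pi fun l => B.estimateLaw c ε h l)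
    (hrun.measurable_hist ht.le) (hrun.measurable_estimate t ht) (hrun.estimate t ht) hf

/-- Only one group is observed at a time, so the product law reduces to its marginal. -/
theorem IsRun.lintegral_observe (hrun : B.IsRun P c ε T θ A X) {t : ℕ} (ht : t < T) (e : Fin ρ)
    {f : (Fin t → B.Round) × B.Joint → ℝ → ENNReal} (hf : Measurable (Function.uncurry f)) :
    ∫⁻ ω, f (B.hist θ A X t ω, A t ω) (X t ω e) ∂P =
      ∫⁻ ω, ∫⁻ y, f (B.hist θ A X t ω, A t ω) y ∂(B.reward e (B.proj (A t ω) e)) ∂P := by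
  have hY : Measurable fun ω => (B.hist θ A X t ω, θ t ω, A t ω) :=
    (hrun.measurable_hist ht.le).prodMk
      ((hrun.measurable_estimate t ht).prodMk (hrun.measurable_arm t ht))
  have := lintegral_eq_of_condDistrib
    (κ := fun p : (Fin t → B.Round) × (B.Loc → ℝ) × B.Joint =>
      Measure.pi fun e => B.reward e (B.proj p.2.2 e))
    hY (hrun.measurable_reward t ht) (hrun.observe t ht)
    (f := fun p => f (p.1.1, p.1.2.2) (p.2 e))
    (hf.comp (g := Function.uncurry f) (f := fun p : ((Fin t → B.Round) × (B.Loc → ℝ) × B.Joint) ×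
      (Fin ρ → ℝ) => ((p.1.1, p.1.2.2), p.2 e)) (by fun_prop))
  rw [this]
  refine lintegral_congr fun ω => ?_
  exact (measurePreserving_eval (fun e => B.reward e (B.proj (A t ω) e)) e).lintegral_comp
    (f := f (B.hist θ A X t ω, A t ω)) (hf.comp measurable_prodMk_left)

theorem IsRun.integrable_reward (hrun : B.IsRun P c ε T θ A X) {σ : ℝ} (hσ : 0 < σ)
    (hB : B.Subgaussian σ) {t : ℕ} (ht : t < T) (e : Fin ρ) :
    Integrable (fun ω => X t ω e) P := by
  refine ⟨((measurable_pi_apply e).comp (hrun.measurable_reward t ht)).aestronglyMeasurable, ?_⟩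
  show ∫⁻ ω, ‖X t ω e‖ₑ ∂P < ⊤
  rw [hrun.lintegral_observe ht e (f := fun _ y => ‖y‖ₑ) (by fun_prop)]
  calc _ ≤ ∫⁻ ω, ENNReal.ofReal (3 * σ) ∂P := by
        refine lintegral_mono fun ω => ?_
        have h1 := integral_abs_le_of_tail _ hσ (hB e (B.proj (A t ω) e))
        have h2 := integrable_id_of_tail _ hσ (hB e (B.proj (A t ω) e))
        rw [← ofReal_integral_norm_eq_lintegral_enorm h2]
        exact ENNReal.ofReal_le_ofReal h1
    _ < ⊤ := by rw [lintegral_const, measure_univ, mul_one]; exact ENNReal.ofReal_lt_top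

theorem IsRun.integral_reward (hrun : B.IsRun P c ε T θ A X) {σ : ℝ} (hσ : 0 < σ)
    (hB : B.Subgaussian σ) {t : ℕ} (ht : t < T) (e : Fin ρ) :
    ∫ ω, X t ω e ∂P = ∫ ω, B.localMean e (B.proj (A t ω) e) ∂P := by
  have hY : Measurable fun ω => (B.hist θ A X t ω, θ t ω, A t ω) :=
    (hrun.measurable_hist ht.le).prodMk
      ((hrun.measurable_estimate t ht).prodMk (hrun.measurable_arm t ht))
  have := integral_eq_of_condDistrib
    (κ := fun p : (Fin t → B.Round) × (B.Loc → ℝ) × B.Joint =>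
      Measure.pi fun e => B.reward e (B.proj p.2.2 e))
    hY (hrun.measurable_reward t ht) (hrun.observe t ht)
    (f := fun x => x e) (measurable_pi_apply e).stronglyMeasurable
    (hrun.integrable_reward hσ hB ht e)
  rw [this]
  refine integral_congr_ae (Filter.Eventually.of_forall fun ω => ?_)
  exact integral_comp_eval (μ := fun e => B.reward e (B.proj (A t ω) e)) (f := fun y => y)
    measurable_id.aestronglyMeasurable

theorem IsRun.integrable_comp_arm (hrun : B.IsRun P c ε T θ A X) {t : ℕ} (ht : t < T)
    (f : B.Joint → ℝ) : Integrable (fun ω => f (A t ω)) P := by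
  obtain ⟨M, hM⟩ := (Set.finite_range fun a => ‖f a‖).bddAbove
  exact Integrable.of_bound
    ((Measurable.of_discrete (f := f)).comp (hrun.measurable_arm t ht)).aestronglyMeasurable M
    (Filter.Eventually.of_forall fun ω => hM ⟨A t ω, rfl⟩)

theorem IsRun.regret_eq (hrun : B.IsRun P c ε T θ A X) {σ : ℝ} (hσ : 0 < σ)
    (hB : B.Subgaussian σ) (o : B.Joint) :
    B.regret P o T X = ∑ t ∈ Finset.range T, ∫ ω, B.gap o (A t ω) ∂P := by
  unfold regret
  have hint : ∀ t ∈ Finset.range T, Integrable (fun ω => ∑ e : Fin ρ, X t ω e) P := fun t ht =>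
    integrable_finsetSum _ fun e _ => hrun.integrable_reward hσ hB (Finset.mem_range.1 ht) e
  rw [integral_finsetSum _ fun t ht => (integrable_const (B.mean o)).sub' (hint t ht)]
  refine Finset.sum_congr rfl fun t ht => ?_
  have ht' := Finset.mem_range.1 ht
  unfold gap
  rw [integral_sub (integrable_const _) (hint t ht),
    integral_sub (integrable_const _) (hrun.integrable_comp_arm ht' B.mean),
    integral_finsetSum _ fun e _ => hrun.integrable_reward hσ hB ht' e]
  unfold mean
  rw [integral_finsetSum _ fun e _ =>
    hrun.integrable_comp_arm ht' fun a => B.localMean e (B.proj a e)]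
  congr 1
  exact Finset.sum_congr rfl fun e _ => hrun.integral_reward hσ hB ht' e

end Run

end MAMAB

/-! ### Concentration of empirical means and of estimates -/

namespace MAMAB

variable {m ρ : ℕ} {B : MAMAB m ρ}

theorem card_loc (B : MAMAB m ρ) : Fintype.card B.Loc = B.Aloc := Fintype.card_sigma

theorem rewardSum_eq_zero_of_count {t : ℕ} {h : Fin t → B.Round} {l : B.Loc}
    (h0 : B.count h l = 0) : B.rewardSum h l = 0 := by
  unfold count at h0
  unfold rewardSum
  rw [Finset.card_eq_zero.1 h0, Finset.sum_empty]

/-- The sum of the centred rewards of the local arm `l`. -/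
noncomputable def deviation {t : ℕ} (h : Fin t → B.Round) (l : B.Loc) : ℝ :=
  B.rewardSum h l - B.count h l * B.localMean l.1 l.2

theorem measurable_deviation {t : ℕ} (l : B.Loc) :
    Measurable fun h : Fin t → B.Round => deviation h l :=
  (B.measurable_rewardSum l).sub (((measurable_from_top (f := fun n : ℕ => (n : ℝ))).comp
    (B.measurable_count l)).mul_const _)

theorem measurable_count_real {t : ℕ} (l : B.Loc) :
    Measurable fun h : Fin t → B.Round => (B.count h l : ℝ) :=
  (measurable_from_top (f := fun n : ℕ => (n : ℝ))).comp (B.measurable_count l)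

/-- The constant in the confidence radius of the empirical means. -/
noncomputable def confidence (σ : ℝ) : ℝ := 3 * σ + 3 * Real.sqrt (varianceProxy σ)

theorem confidence_pos {σ : ℝ} (hσ : 0 < σ) : 0 < confidence σ := by
  unfold confidence; positivity

theorem abs_localMean_le {σ : ℝ} (hσ : 0 < σ) (hB : B.Subgaussian σ) (e : Fin ρ)
    (b : B.LocalArm e) : |B.localMean e b| ≤ 3 * σ :=
  abs_integral_le_of_tail _ hσ (hB e b)

/-- The radius uses `count + 1` to match the variance of the estimates. An unpulled local arm has
empirical mean 0 and error at most `3σ`, the first summand of `confidence`; otherwise `n + 1 ≤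
9n/4`, and the factor 3/2 turns the 2 of the hypothesis into the 3 of the second summand. -/
theorem abs_empMean_sub_le {σ : ℝ} (hσ : 0 < σ) (hB : B.Subgaussian σ) {t : ℕ}
    {h : Fin t → B.Round} {l : B.Loc} {r : ℝ} (hr : 1 ≤ r)
    (hd : |deviation h l| ≤ 2 * Real.sqrt (varianceProxy σ * B.count h l * r)) :
    |B.empMean h l - B.localMean l.1 l.2| ≤
      confidence σ * Real.sqrt (r / ((B.count h l : ℝ) + 1)) := by
  have hv := varianceProxy_pos hσ
  have hsv : 0 ≤ Real.sqrt (varianceProxy σ) := Real.sqrt_nonneg _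
  rcases Nat.eq_zero_or_pos (B.count h l) with h0 | h0
  · rw [empMean_eq, h0]
    simp only [Nat.cast_zero, div_zero, zero_sub, abs_neg, zero_add, div_one]
    calc |B.localMean l.1 l.2| ≤ 3 * σ := abs_localMean_le hσ hB _ _
      _ ≤ confidence σ * 1 := by unfold confidence; linarith
      _ ≤ _ := by
        gcongr
        · exact (confidence_pos hσ).le
        · exact Real.one_le_sqrt.2 hr
  · set n : ℝ := (B.count h l : ℝ) with hn
    have hn1 : 1 ≤ n := by rw [hn]; exact_mod_cast h0
    have hn0 : 0 < n := by linarith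
    have e1 : B.empMean h l - B.localMean l.1 l.2 = deviation h l / n := by
      rw [empMean_eq, deviation, ← hn]; field_simp
    have hsqrt : Real.sqrt (varianceProxy σ * n * r) =
        Real.sqrt (varianceProxy σ) * (n * Real.sqrt (r / n)) := by
      rw [mul_assoc, Real.sqrt_mul hv.le]
      congr 1
      rw [show n * r = n ^ 2 * (r / n) by field_simp, Real.sqrt_mul (by positivity),
        Real.sqrt_sq hn0.le]
    have h2 : Real.sqrt (r / n) ≤ 3 / 2 * Real.sqrt (r / (n + 1)) := by
      rw [show (3 / 2 : ℝ) = Real.sqrt (9 / 4) by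
        rw [show (9 / 4 : ℝ) = (3 / 2) ^ 2 by norm_num, Real.sqrt_sq (by norm_num)],
        ← Real.sqrt_mul (by norm_num)]
      refine Real.sqrt_le_sqrt ?_
      rw [div_le_iff₀ hn0]
      have : 9 / 4 * (r / (n + 1)) * n = r * (9 / 4 * n / (n + 1)) := by field_simp
      rw [this]
      have : 1 ≤ 9 / 4 * n / (n + 1) := by rw [le_div_iff₀ (by linarith)]; linarith
      nlinarith
    rw [e1, abs_div, abs_of_pos hn0, div_le_iff₀ hn0]
    calc |deviation h l| ≤ _ := hd
      _ = 2 * (Real.sqrt (varianceProxy σ) * Real.sqrt (r / n)) * n := by rw [hsqrt]; ring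
      _ ≤ 2 * (Real.sqrt (varianceProxy σ) * (3 / 2 * Real.sqrt (r / (n + 1)))) * n := by gcongr
      _ = 3 * Real.sqrt (varianceProxy σ) * Real.sqrt (r / (n + 1)) * n := by ring
      _ ≤ _ := by
        gcongr
        unfold confidence
        linarith

section Run

variable {Ω : Type*} {θ : ℕ → Ω → B.Loc → ℝ} {A : ℕ → Ω → B.Joint} {X : ℕ → Ω → Fin ρ → ℝ}

theorem deviation_hist_succ (t : ℕ) (ω : Ω) (l : B.Loc) :
    deviation (B.hist θ A X (t + 1) ω) l = deviation (B.hist θ A X t ω) l +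
      if B.proj (A t ω) l.1 = l.2 then X t ω l.1 - B.localMean l.1 l.2 else 0 := by
  unfold deviation
  rw [rewardSum_hist_succ, count_hist_succ]
  split_ifs <;> push_cast <;> ring

variable [MeasurableSpace Ω] {P : Measure Ω} [IsProbabilityMeasure P] {c ε : ℝ} {T : ℕ}

/-- A supermartingale argument: each round multiplies the exponential by 1 or, if `l` is pulled, by
a factor of conditional expectation at most 1. -/
theorem IsRun.lintegral_exp_deviation_le (hrun : B.IsRun P c ε T θ A X) {σ : ℝ} (hσ : 0 < σ)
    (hB : B.Subgaussian σ) (l : B.Loc) (s : ℝ) {t : ℕ} (ht : t ≤ T) :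
    ∫⁻ ω, ENNReal.ofReal (Real.exp (s * deviation (B.hist θ A X t ω) l -
      varianceProxy σ * s ^ 2 * B.count (B.hist θ A X t ω) l)) ∂P ≤ 1 := by
  induction t with
  | zero => simp [deviation, count_hist_zero, rewardSum_hist_zero]
  | succ t ih =>
    have ht' : t < T := ht
    let W : (Fin t → B.Round) → ENNReal := fun h => ENNReal.ofReal (Real.exp
      (s * deviation h l - varianceProxy σ * s ^ 2 * B.count h l))
    have hW : Measurable W := by
      have h1 := measurable_deviation (B := B) (t := t) l
      have h2 := measurable_count_real (B := B) (t := t) l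
      exact ENNReal.measurable_ofReal.comp (Real.measurable_exp.comp
        ((h1.const_mul s).sub (h2.const_mul _)))
    let V : B.Joint → ℝ → ENNReal := fun a y => if B.proj a l.1 = l.2 then
      ENNReal.ofReal (Real.exp (s * (y - B.localMean l.1 l.2) - varianceProxy σ * s ^ 2)) else 1
    have hV : Measurable (Function.uncurry V) := by
      refine Measurable.ite ?_ (by fun_prop) measurable_const
      exact measurable_fst (show MeasurableSet {a : B.Joint | B.proj a l.1 = l.2} from .of_discrete)
    have hf : Measurable (Function.uncurry
        fun (p : (Fin t → B.Round) × B.Joint) (y : ℝ) => W p.1 * V p.2 y) := by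
      refine (hW.comp (by fun_prop)).mul (hV.comp
        (f := fun p : ((Fin t → B.Round) × B.Joint) × ℝ => (p.1.2, p.2)) (by fun_prop))
    have hstep : ∀ ω, ENNReal.ofReal (Real.exp (s * deviation (B.hist θ A X (t + 1) ω) l -
        varianceProxy σ * s ^ 2 * B.count (B.hist θ A X (t + 1) ω) l)) =
        W (B.hist θ A X t ω) * V (A t ω) (X t ω l.1) := by
      intro ω
      rw [deviation_hist_succ, count_hist_succ]
      by_cases hp : B.proj (A t ω) l.1 = l.2
      · simp only [W, V, hp, if_true]
        rw [← ENNReal.ofReal_mul (Real.exp_pos _).le, ← Real.exp_add]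
        congr 2
        push_cast
        ring
      · simp [W, V, hp]
    simp_rw [hstep]
    rw [hrun.lintegral_observe ht' l.1
      (f := fun (p : (Fin t → B.Round) × B.Joint) (y : ℝ) => W p.1 * V p.2 y) hf]
    refine le_trans (lintegral_mono fun ω => ?_) (ih ht'.le)
    dsimp only
    rw [lintegral_const_mul _ (show Measurable (V (A t ω)) from hV.comp measurable_prodMk_left)]
    refine (mul_le_mul_right (b := _) (c := 1) ?_ _).trans_eq (mul_one _)
    by_cases hp : B.proj (A t ω) l.1 = l.2
    · simp only [V, hp, if_true]
      exact lintegral_exp_centered_le_one _ hσ (hB l.1 l.2) s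
    · simp [V, hp]

/-- Fixing the value of the random count allows the optimal deterministic `s = ±√(r / (vn))`, `v`
the variance proxy; then the exponent is at least `2r - r = r` on the event. -/
theorem IsRun.measure_deviation_count_le (hrun : B.IsRun P c ε T θ A X) {σ : ℝ} (hσ : 0 < σ)
    (hB : B.Subgaussian σ) (l : B.Loc) {r : ℝ} (hr : 0 ≤ r) {t : ℕ} (ht : t ≤ T) {n : ℕ}
    (hn : 1 ≤ n) :
    P {ω | B.count (B.hist θ A X t ω) l = n ∧
      2 * Real.sqrt (varianceProxy σ * n * r) < |deviation (B.hist θ A X t ω) l|} ≤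
      ENNReal.ofReal (2 * Real.exp (-r)) := by
  have hv := varianceProxy_pos hσ
  have hn0 : (0 : ℝ) < n := by exact_mod_cast hn
  have onesided : ∀ s : ℝ, s ^ 2 = r / (varianceProxy σ * n) →
      P {ω | B.count (B.hist θ A X t ω) l = n ∧
        2 * r ≤ s * deviation (B.hist θ A X t ω) l} ≤ ENNReal.ofReal (Real.exp (-r)) := by
    intro s hs
    have hint := hrun.lintegral_exp_deviation_le hσ hB l s ht
    have hmarkov := meas_ge_le_lintegral_div (μ := P)
      (f := fun ω => ENNReal.ofReal (Real.exp (s * deviation (B.hist θ A X t ω) l -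
        varianceProxy σ * s ^ 2 * B.count (B.hist θ A X t ω) l)))
      (by
        have h1 := (measurable_deviation (B := B) (t := t) l).comp (hrun.measurable_hist ht)
        have h2 := (measurable_count_real (B := B) (t := t) l).comp (hrun.measurable_hist ht)
        exact (ENNReal.measurable_ofReal.comp (Real.measurable_exp.comp
          ((h1.const_mul s).sub (h2.const_mul _)))).aemeasurable)
      (ε := ENNReal.ofReal (Real.exp r)) (by simp [Real.exp_pos]) ENNReal.ofReal_ne_top
    refine (measure_mono ?_).trans (hmarkov.trans ?_)
    · rintro ω ⟨h1, h2⟩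
      refine ENNReal.ofReal_le_ofReal (Real.exp_le_exp.2 ?_)
      rw [h1, hs]
      have : varianceProxy σ * (r / (varianceProxy σ * n)) * n = r := by field_simp
      rw [this]; linarith
    · refine (ENNReal.div_le_div_right hint _).trans_eq ?_
      rw [Real.exp_neg, ENNReal.ofReal_inv_of_pos (Real.exp_pos _), one_div]
  set s := Real.sqrt (r / (varianceProxy σ * n)) with hs
  have hs2 : s ^ 2 = r / (varianceProxy σ * n) := Real.sq_sqrt (by positivity)
  have hs0 : 0 ≤ s := Real.sqrt_nonneg _
  have hprod : s * (2 * Real.sqrt (varianceProxy σ * n * r)) = 2 * r := by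
    rw [hs, mul_left_comm, ← Real.sqrt_mul (by positivity)]
    rw [show r / (varianceProxy σ * n) * (varianceProxy σ * n * r) = r ^ 2 by field_simp,
      Real.sqrt_sq hr]
  refine (measure_mono (t := {ω | B.count (B.hist θ A X t ω) l = n ∧
      2 * r ≤ s * deviation (B.hist θ A X t ω) l} ∪
      {ω | B.count (B.hist θ A X t ω) l = n ∧
      2 * r ≤ -s * deviation (B.hist θ A X t ω) l}) ?_).trans ((measure_union_le _ _).trans ?_)
  · rintro ω ⟨h1, h2⟩
    rcases lt_abs.1 h2 with h | h
    · exact Or.inl ⟨h1, by rw [← hprod]; exact mul_le_mul_of_nonneg_left h.le hs0⟩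
    · refine Or.inr ⟨h1, ?_⟩
      rw [← hprod, neg_mul, ← mul_neg]
      exact mul_le_mul_of_nonneg_left h.le hs0
  · rw [two_mul (Real.exp _), ENNReal.ofReal_add (Real.exp_pos _).le (Real.exp_pos _).le]
    exact add_le_add (onesided s hs2) (onesided (-s) (by rw [neg_sq, hs2]))

theorem IsRun.measure_empMean_le (hrun : B.IsRun P c ε T θ A X) {σ : ℝ} (hσ : 0 < σ)
    (hB : B.Subgaussian σ) (l : B.Loc) {r : ℝ} (hr : 1 ≤ r) {t : ℕ} (ht : t ≤ T) :
    P {ω | confidence σ * Real.sqrt (r / ((B.count (B.hist θ A X t ω) l : ℝ) + 1)) <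
        |B.empMean (B.hist θ A X t ω) l - B.localMean l.1 l.2|} ≤
      ENNReal.ofReal (T * (2 * Real.exp (-r))) := by
  refine (measure_mono (t := ⋃ n ∈ Finset.Icc 1 t, {ω | B.count (B.hist θ A X t ω) l = n ∧
      2 * Real.sqrt (varianceProxy σ * n * r) < |deviation (B.hist θ A X t ω) l|}) ?_).trans
      ((measure_biUnion_finset_le _ _).trans ?_)
  · intro ω hω
    rw [Set.mem_ofPred_eq] at hω
    simp only [Set.mem_iUnion]
    have hdev : 2 * Real.sqrt (varianceProxy σ * B.count (B.hist θ A X t ω) l * r) <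
        |deviation (B.hist θ A X t ω) l| := by
      by_contra hcon
      exact absurd (abs_empMean_sub_le hσ hB hr (not_lt.1 hcon)) (not_le.2 hω)
    refine ⟨B.count (B.hist θ A X t ω) l, Finset.mem_Icc.2 ⟨?_, count_hist_le _ _ _ _⟩, rfl, hdev⟩
    -- With count 0 the deviation vanishes and the strict inequality fails, so the union over counts
    -- may start at 1.
    by_contra hcon
    have h0 : B.count (B.hist θ A X t ω) l = 0 := by omega
    have : deviation (B.hist θ A X t ω) l = 0 := by
      rw [deviation, rewardSum_eq_zero_of_count h0, h0]; simp
    rw [this, h0] at hdev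
    simp at hdev
  · calc _ ≤ ∑ n ∈ Finset.Icc 1 t, ENNReal.ofReal (2 * Real.exp (-r)) :=
          Finset.sum_le_sum fun n hn => hrun.measure_deviation_count_le hσ hB l (by linarith) ht
            (Finset.mem_Icc.1 hn).1
      _ = t * ENNReal.ofReal (2 * Real.exp (-r)) := by simp
      _ ≤ T * ENNReal.ofReal (2 * Real.exp (-r)) := by gcongr
      _ = _ := by rw [ENNReal.ofReal_mul (p := (T : ℝ)) (by positivity), ENNReal.ofReal_natCast]

theorem IsRun.measure_estimate_le (hrun : B.IsRun P c ε T θ A X) (hc : 0 ≤ c) (hε : 0 ≤ ε)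
    (hε1 : ε ≤ 1) (l : B.Loc) {r : ℝ} (hr : 0 ≤ r) {t : ℕ} (ht : t < T) :
    P {ω | Real.sqrt (2 * (c / ((B.count (B.hist θ A X t ω) l : ℝ) + 1)) * r) <
        |θ t ω l - B.empMean (B.hist θ A X t ω) l|} ≤ ENNReal.ofReal (2 * Real.exp (-r)) := by
  let S : Set ((Fin t → B.Round) × (B.Loc → ℝ)) :=
    {p | Real.sqrt (2 * (c / ((B.count p.1 l : ℝ) + 1)) * r) < |p.2 l - B.empMean p.1 l|}
  have hS : MeasurableSet S := by
    have hfst : Measurable (Prod.fst : (Fin t → B.Round) × (B.Loc → ℝ) → Fin t → B.Round) :=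
      measurable_fst
    have h1 := (measurable_count_real (B := B) (t := t) l).comp hfst
    have h2 := (B.measurable_empMean (t := t) l).comp hfst
    refine measurableSet_lt (Real.continuous_sqrt.measurable.comp
      (((measurable_const.div (h1.add_const 1)).const_mul 2).mul_const r)) ?_
    exact continuous_abs.measurable.comp
      (((measurable_pi_apply l).comp measurable_snd).sub h2)
  have hmeas : MeasurableSet {ω | (B.hist θ A X t ω, θ t ω) ∈ S} :=
    ((hrun.measurable_hist ht.le).prodMk (hrun.measurable_estimate t ht)) hS
  have e1 : P {ω | (B.hist θ A X t ω, θ t ω) ∈ S} =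
      ∫⁻ ω, S.indicator 1 (B.hist θ A X t ω, θ t ω) ∂P := by
    rw [← lintegral_indicator_one hmeas]; rfl
  change P {ω | (B.hist θ A X t ω, θ t ω) ∈ S} ≤ _
  rw [e1, hrun.lintegral_estimate ht (f := S.indicator 1) (measurable_one.indicator hS)]
  calc _ ≤ ∫⁻ ω, ENNReal.ofReal (2 * Real.exp (-r)) ∂P := by
        refine lintegral_mono fun ω => ?_
        set h := B.hist θ A X t ω
        have := fun l => B.isProbabilityMeasure_estimateLaw (c := c) hε hε1 h l
        let U : Set ℝ := {y | Real.sqrt (2 * (c / ((B.count h l : ℝ) + 1)) * r) <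
          |y - B.empMean h l|}
        have hU : MeasurableSet U := measurableSet_lt measurable_const (by fun_prop)
        have e2 := (measurePreserving_eval (fun l => B.estimateLaw c ε h l) l).lintegral_comp
          (f := U.indicator 1) (measurable_one.indicator hU)
        rw [lintegral_indicator_one hU] at e2
        exact e2.trans_le (B.estimateLaw_tail_le hε1 hc h l hr)
    _ = _ := by simp

end Run

end MAMAB

/-! ### The sum of truncated radii over the pulls of a local arm -/

/-- Only terms with `√(n + 1) ≤ Q / d` survive, and `∑ 1 / √(n + 1)` is at most twice the square
root of their number. The induction carries the minimum of `√M` and `Q / d`. -/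
theorem sum_truncated_inv_sqrt_le {Q d : ℝ} (hQ : 0 ≤ Q) (hd : 0 < d) (M : ℕ) :
    ∑ n ∈ Finset.range M, (if d ≤ Q / Real.sqrt ((n : ℝ) + 1) then Q / Real.sqrt ((n : ℝ) + 1)
      else 0) ≤ 2 * Q ^ 2 / d := by
  have key : ∑ n ∈ Finset.range M, (if d ≤ Q / Real.sqrt ((n : ℝ) + 1) then
      Q / Real.sqrt ((n : ℝ) + 1) else 0) ≤ 2 * Q * min (Real.sqrt M) (Q / d) := by
    induction M with
    | zero => simp [div_nonneg hQ hd.le]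
    | succ M ih =>
      rw [Finset.sum_range_succ]
      have hs : 0 < Real.sqrt ((M : ℝ) + 1) := Real.sqrt_pos.2 (by positivity)
      have hmono : Real.sqrt M ≤ Real.sqrt ((M : ℝ) + 1) := Real.sqrt_le_sqrt (by linarith)
      push_cast
      split_ifs with h
      · have h1 : Real.sqrt ((M : ℝ) + 1) ≤ Q / d := by
          rw [le_div_iff₀ hs] at h
          rw [le_div_iff₀ hd]; linarith
        rw [min_eq_left (hmono.trans h1)] at ih
        rw [min_eq_left h1]
        have h2 : 1 / Real.sqrt ((M : ℝ) + 1) ≤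
            2 * (Real.sqrt ((M : ℝ) + 1) - Real.sqrt M) := by
          rw [div_le_iff₀ hs]
          have e1 := Real.mul_self_sqrt (show (0 : ℝ) ≤ (M : ℝ) + 1 by positivity)
          have e2 := Real.mul_self_sqrt (show (0 : ℝ) ≤ (M : ℝ) by positivity)
          nlinarith [sq_nonneg (Real.sqrt ((M : ℝ) + 1) - Real.sqrt M)]
        have h3 := mul_le_mul_of_nonneg_left h2 hQ
        rw [mul_one_div] at h3
        linarith
      · rw [add_zero]
        refine ih.trans ?_
        gcongr
  refine key.trans ?_
  calc 2 * Q * min (Real.sqrt M) (Q / d) ≤ 2 * Q * (Q / d) := by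
        gcongr; exact min_le_right _ _
    _ = _ := by ring

/-! ### Charging the gap to pulls: the deterministic argument -/

namespace MAMAB

variable {m ρ : ℕ} (B : MAMAB m ρ)

/-- The groups for which the joint arm `a` does not use the local arm of `o`. -/
def diffGroups (o a : B.Joint) : Finset (Fin ρ) :=
  Finset.univ.filter fun e => B.proj a e ≠ B.proj o e

/-- The confidence radius of the local arm `l`, proportional to `W`. -/
noncomputable def radius (W : ℝ) {t : ℕ} (h : Fin t → B.Round) (l : B.Loc) : ℝ :=
  W / Real.sqrt ((B.count h l : ℝ) + 1)

/-- The sum of the estimates of the local arms of a joint arm. -/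
def value (x : B.Loc → ℝ) (a : B.Joint) : ℝ := ∑ e : Fin ρ, x ⟨e, B.proj a e⟩

/-- The gap of `a` exceeds twice the sum of the radii of its non-optimal local arms. -/
def WellSampled (W : ℝ) (o : B.Joint) {t : ℕ} (h : Fin t → B.Round) (a : B.Joint) : Prop :=
  2 * ∑ e ∈ B.diffGroups o a, B.radius W h ⟨e, B.proj a e⟩ < B.gap o a

open Classical in
/-- The groups in which `a` deviates from `o` and whose optimal local arm has a large radius. -/
noncomputable def undersampled (W : ℝ) (o : B.Joint) {t : ℕ} (h : Fin t → B.Round)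
    (a : B.Joint) : Finset (Fin ρ) :=
  (B.diffGroups o a).filter fun e => B.gap o a ≤ 4 * ρ * B.radius W h ⟨e, B.proj o e⟩

/-- The joint arm `a` is played, despite being well sampled, unless the estimates of the optimal
local arms of the groups `V` increase. -/
structure Blocks (W δ : ℝ) (o : B.Joint) (V : Finset (Fin ρ)) {t : ℕ} (h : Fin t → B.Round)
    (x : B.Loc → ℝ) (a : B.Joint) : Prop where
  le_gap : δ ≤ B.gap o a
  wellSampled : B.WellSampled W o h a
  undersampled_eq : B.undersampled W o h a = V
  value_le : ∀ a', (∀ e ∈ V, B.proj a' e ≠ B.proj o e) → B.value x a' ≤ B.value x a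
  le_upper : ∀ e ∈ B.diffGroups o a,
    x ⟨e, B.proj a e⟩ ≤ B.localMean e (B.proj a e) + B.radius W h ⟨e, B.proj a e⟩
  lower_le : ∀ e ∈ B.diffGroups o a, e ∉ V →
    B.localMean e (B.proj o e) - B.radius W h ⟨e, B.proj o e⟩ ≤ x ⟨e, B.proj o e⟩

open Classical in
/-- The largest gap of a joint arm that is blocking. -/
noncomputable def blockedGap (W δ : ℝ) (o : B.Joint) (V : Finset (Fin ρ)) {t : ℕ}
    (h : Fin t → B.Round) (x : B.Loc → ℝ) : ENNReal :=
  ⨆ a : B.Joint, if B.Blocks W δ o V h x a then ENNReal.ofReal (B.gap o a) else 0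

/-- The local arms of `o` for the groups in `V`. -/
def optimalLocals (o : B.Joint) (V : Finset (Fin ρ)) : Finset B.Loc :=
  V.image fun e => ⟨e, B.proj o e⟩

variable {B}

theorem mem_diffGroups {o a : B.Joint} {e : Fin ρ} :
    e ∈ B.diffGroups o a ↔ B.proj a e ≠ B.proj o e := by simp [diffGroups]

theorem mem_optimalLocals {o : B.Joint} {V : Finset (Fin ρ)} {l : B.Loc} :
    l ∈ B.optimalLocals o V ↔ l.1 ∈ V ∧ l.2 = B.proj o l.1 := by
  obtain ⟨e, b⟩ := l
  rw [optimalLocals, Finset.mem_image]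
  constructor
  · rintro ⟨e', he', h⟩
    cases h
    exact ⟨he', rfl⟩
  · rintro ⟨h1, h2⟩
    exact ⟨e, h1, Sigma.ext rfl (heq_of_eq h2.symm)⟩

theorem card_optimalLocals (o : B.Joint) (V : Finset (Fin ρ)) :
    (B.optimalLocals o V).card = V.card :=
  Finset.card_image_of_injective _ fun _ _ h => congrArg Sigma.fst h

theorem undersampled_subset {W : ℝ} {o : B.Joint} {t : ℕ} {h : Fin t → B.Round} {a : B.Joint} :
    B.undersampled W o h a ⊆ B.diffGroups o a := by
  classical
  exact Finset.filter_subset _ _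

theorem value_sub_value (x : B.Loc → ℝ) (o a : B.Joint) :
    B.value x o - B.value x a =
      ∑ e ∈ B.diffGroups o a, (x ⟨e, B.proj o e⟩ - x ⟨e, B.proj a e⟩) := by
  unfold value
  rw [← Finset.sum_sub_distrib]
  refine (Finset.sum_subset (Finset.subset_univ _) fun e _ he => ?_).symm
  rw [mem_diffGroups, not_not] at he
  rw [he, sub_self]

theorem gap_eq_sum (o a : B.Joint) :
    B.gap o a = ∑ e ∈ B.diffGroups o a,
      (B.localMean e (B.proj o e) - B.localMean e (B.proj a e)) :=
  value_sub_value (fun l => B.localMean l.1 l.2) o a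

theorem card_diffGroups_le (o a : B.Joint) : (B.diffGroups o a).card ≤ ρ :=
  (Finset.card_le_univ _).trans_eq (Fintype.card_fin ρ)

/-- Every clause of `Blocks` avoids the estimates of the optimal local arms of `V`: the blocking arm
deviates from `o` on `V`, its competitors are required to do so, upper bounds concern non-optimal
local arms, and lower bounds omit `V`. -/
theorem Blocks.of_agree {W δ : ℝ} {o : B.Joint} {V : Finset (Fin ρ)} {t : ℕ}
    {h : Fin t → B.Round} {x y : B.Loc → ℝ} {a : B.Joint}
    (hxy : ∀ l ∉ B.optimalLocals o V, x l = y l) (hx : B.Blocks W δ o V h x a) :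
    B.Blocks W δ o V h y a := by
  have hV : V ⊆ B.diffGroups o a := hx.undersampled_eq ▸ undersampled_subset
  have hval : ∀ a', (∀ e ∈ V, B.proj a' e ≠ B.proj o e) → B.value x a' = B.value y a' := by
    intro a' ha'
    refine Finset.sum_congr rfl fun e _ => hxy _ fun hmem => ?_
    rw [mem_optimalLocals] at hmem
    exact ha' e hmem.1 hmem.2
  have ha : ∀ e ∈ V, B.proj a e ≠ B.proj o e := fun e he => mem_diffGroups.1 (hV he)
  refine ⟨hx.le_gap, hx.wellSampled, hx.undersampled_eq, fun a' ha' => ?_, fun e he => ?_,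
    fun e he heV => ?_⟩
  · rw [← hval a' ha', ← hval a ha]
    exact hx.value_le a' ha'
  · rw [← hxy _ fun hmem => mem_diffGroups.1 he (mem_optimalLocals.1 hmem).2]
    exact hx.le_upper e he
  · rw [← hxy _ fun hmem => heV (mem_optimalLocals.1 hmem).1]
    exact hx.lower_le e he heV

theorem blockedGap_of_agree {W δ : ℝ} {o : B.Joint} {V : Finset (Fin ρ)} {t : ℕ}
    {h : Fin t → B.Round} {x y : B.Loc → ℝ}
    (hxy : ∀ l ∉ B.optimalLocals o V, x l = y l) :
    B.blockedGap W δ o V h x = B.blockedGap W δ o V h y := by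
  unfold blockedGap
  congr 1
  funext a
  have : B.Blocks W δ o V h x a ↔ B.Blocks W δ o V h y a :=
    ⟨fun H => H.of_agree hxy, fun H => H.of_agree fun l hl => (hxy l hl).symm⟩
  by_cases hx : B.Blocks W δ o V h x a
  · rw [if_pos hx, if_pos (this.1 hx)]
  · rw [if_neg hx, if_neg (mt this.2 hx)]

/-- If the optimal local arms of the groups `V` are not underestimated, one of them is pulled. -/
theorem Blocks.exists_pull {W δ : ℝ} (hδ : 0 < δ) {o : B.Joint} {V : Finset (Fin ρ)}
    {t : ℕ} {h : Fin t → B.Round} {x : B.Loc → ℝ} {a : B.Joint} (hx : B.Blocks W δ o V h x a)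
    (hV : ∀ e ∈ V, B.localMean e (B.proj o e) ≤ x ⟨e, B.proj o e⟩) {α : B.Joint}
    (hα : ∀ a', B.value x a' ≤ B.value x α) :
    ∃ e ∈ V, B.proj α e = B.proj o e ∧ B.gap o a ≤ 4 * ρ * B.radius W h ⟨e, B.proj o e⟩ := by
  classical
  have hgap : 0 < B.gap o a := hδ.trans_le hx.le_gap
  by_contra hcon
  push Not at hcon
  have hund : ∀ e, e ∈ V ↔ e ∈ B.diffGroups o a ∧
      B.gap o a ≤ 4 * ρ * B.radius W h ⟨e, B.proj o e⟩ := by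
    intro e
    rw [← hx.undersampled_eq, undersampled, Finset.mem_filter]
  have hαV : ∀ e ∈ V, B.proj α e ≠ B.proj o e := fun e he heq =>
    absurd ((hund e).1 he).2 (not_le.2 (hcon e he heq))
  -- If the maximizer avoided `o` throughout `V`, the blocking arm `a` would be at least as good as
  -- it, hence as `o`. But `o` beats `a`: from the gap, the radii of `a` take less than half and the
  -- optimal side at most `ρ · gap / (4ρ)`, a quarter.
  have h1 : B.value x o - B.value x a ≤ 0 :=
    sub_nonpos.2 ((hα o).trans (hx.value_le α hαV))
  rw [value_sub_value] at h1
  have hρ : (0 : ℝ) < ρ := by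
    rcases Nat.eq_zero_or_pos ρ with h0 | h0
    · subst h0
      rw [gap_eq_sum, Finset.eq_empty_of_isEmpty (B.diffGroups o a), Finset.sum_empty] at hgap
      exact absurd hgap (lt_irrefl _)
    · exact_mod_cast h0
  have h2 : ∀ e ∈ B.diffGroups o a,
      (B.localMean e (B.proj o e) - B.localMean e (B.proj a e))
        - B.radius W h ⟨e, B.proj a e⟩ - B.gap o a / (4 * ρ) ≤
      x ⟨e, B.proj o e⟩ - x ⟨e, B.proj a e⟩ := by
    intro e he
    have hup := hx.le_upper e he
    have hg : 0 < B.gap o a / (4 * ρ) := by positivity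
    by_cases heV : e ∈ V
    · have := hV e heV
      linarith
    · have hlow := hx.lower_le e he heV
      have hr : B.radius W h ⟨e, B.proj o e⟩ ≤ B.gap o a / (4 * ρ) := by
        rw [le_div_iff₀ (by positivity)]
        have := mt (fun H => (hund e).2 ⟨he, H⟩) heV
        linarith
      linarith
  have h3 := Finset.sum_le_sum h2
  rw [Finset.sum_sub_distrib, Finset.sum_sub_distrib, ← gap_eq_sum, Finset.sum_const,
    nsmul_eq_mul] at h3
  have h4 : ((B.diffGroups o a).card : ℝ) * (B.gap o a / (4 * ρ)) ≤ B.gap o a / 4 := by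
    calc _ ≤ (ρ : ℝ) * (B.gap o a / (4 * ρ)) := by
          gcongr
          exact card_diffGroups_le o a
      _ = _ := by field_simp
  have h5 : 2 * ∑ e ∈ B.diffGroups o a, B.radius W h ⟨e, B.proj a e⟩ < B.gap o a := hx.wellSampled
  linarith

/-- `q W / √(n + 1)`, truncated to the values that are at least `d`. -/
noncomputable def truncatedRadius (d Q : ℝ) (n : ℕ) : ENNReal :=
  if d ≤ Q / Real.sqrt ((n : ℝ) + 1) then ENNReal.ofReal (Q / Real.sqrt ((n : ℝ) + 1)) else 0

theorem sum_truncatedRadius_le {d Q : ℝ} (hd : 0 < d) (hQ : 0 ≤ Q) (M : ℕ) :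
    ∑ n ∈ Finset.range M, truncatedRadius d Q n ≤ ENNReal.ofReal (2 * Q ^ 2 / d) := by
  have h : ∀ n, truncatedRadius d Q n = ENNReal.ofReal
      (if d ≤ Q / Real.sqrt ((n : ℝ) + 1) then Q / Real.sqrt ((n : ℝ) + 1) else 0) := by
    intro n
    unfold truncatedRadius
    split_ifs <;> simp
  simp_rw [h]
  rw [← ENNReal.ofReal_sum_of_nonneg fun n _ => by split_ifs <;> positivity]
  exact ENNReal.ofReal_le_ofReal (sum_truncated_inv_sqrt_le hQ hd M)

theorem ofReal_gap_le_truncatedRadius {q W d g : ℝ} {t : ℕ} {h : Fin t → B.Round} {l : B.Loc}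
    (hd : d ≤ g) (hg : g ≤ q * B.radius W h l) :
    ENNReal.ofReal g ≤ truncatedRadius d (q * W) (B.count h l) := by
  have e : q * B.radius W h l = q * W / Real.sqrt ((B.count h l : ℝ) + 1) := by
    rw [radius, mul_div_assoc]
  rw [e] at hg
  rw [truncatedRadius, if_pos (hd.trans hg)]
  exact ENNReal.ofReal_le_ofReal hg

/-- The bound does not depend on which `a` blocks, so `blockedGap` can be a supremum over joint
arms, and their number never enters. -/
theorem blockedGap_le_of_argmax {W δ : ℝ} (hδ : 0 < δ) {o : B.Joint} {V : Finset (Fin ρ)}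
    {t : ℕ} {h : Fin t → B.Round} {x : B.Loc → ℝ}
    (hV : ∀ e ∈ V, B.localMean e (B.proj o e) ≤ x ⟨e, B.proj o e⟩) {α : B.Joint}
    (hα : ∀ a', B.value x a' ≤ B.value x α) :
    B.blockedGap W δ o V h x ≤ ∑ e : Fin ρ, if B.proj α e = B.proj o e then
      truncatedRadius δ (4 * ρ * W) (B.count h ⟨e, B.proj o e⟩) else 0 := by
  classical
  refine iSup_le fun a => ?_
  split_ifs with hx
  · obtain ⟨e, he, heq, hle⟩ := hx.exists_pull hδ hV hα
    refine le_trans ?_ (Finset.single_le_sum (fun _ _ => zero_le) (Finset.mem_univ e))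
    rw [if_pos heq]
    exact ofReal_gap_le_truncatedRadius hx.le_gap hle
  · exact zero_le

/-- When all estimates are within the radii, the gap of the joint arm that is played is charged
either to a non-optimal local arm that is rarely pulled, or to a blocking joint arm. -/
theorem ofReal_gap_le_of_argmax {W δ : ℝ} (hδ : 0 < δ) {o : B.Joint}
    {d : (e : Fin ρ) → B.LocalArm e → ℝ} {t : ℕ} {h : Fin t → B.Round} {x : B.Loc → ℝ}
    (hx : ∀ l : B.Loc, |x l - B.localMean l.1 l.2| ≤ B.radius W h l) {α : B.Joint}
    (hα : ∀ a', B.value x a' ≤ B.value x α) (hgap : δ ≤ B.gap o α)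
    (hd : ∀ e, B.proj α e ≠ B.proj o e → d e (B.proj α e) ≤ B.gap o α) :
    ENNReal.ofReal (B.gap o α) ≤
      (∑ e : Fin ρ, ∑ b ∈ Finset.univ.erase (B.proj o e), if B.proj α e = b then
        truncatedRadius (d e b) (2 * ρ * W) (B.count h ⟨e, b⟩) else 0) +
      ∑ V : Finset (Fin ρ), B.blockedGap W δ o V h x := by
  classical
  by_cases hw : B.WellSampled W o h α
  -- The arm played is itself blocking, for `V` its own set of undersampled groups.
  · refine le_add_left ?_
    refine le_trans ?_ (Finset.single_le_sum (f := fun V => B.blockedGap W δ o V h x)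
      (fun _ _ => zero_le) (Finset.mem_univ (B.undersampled W o h α)))
    refine le_trans ?_ (le_iSup _ α)
    rw [if_pos]
    refine ⟨hgap, hw, rfl, fun a' _ => hα a', fun e _ => ?_, fun e _ _ => ?_⟩
    · have := (abs_le.1 (hx ⟨e, B.proj α e⟩)).2
      linarith
    · have := (abs_le.1 (hx ⟨e, B.proj o e⟩)).1
      linarith
  · refine le_add_right ?_
    have hw' : B.gap o α ≤ 2 * ∑ e ∈ B.diffGroups o α, B.radius W h ⟨e, B.proj α e⟩ := not_lt.1 hw
    have hpos : 0 < B.gap o α := hδ.trans_le hgap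
    -- Pigeonhole over at most `ρ` groups.
    have hex : ∃ e ∈ B.diffGroups o α, B.gap o α ≤ 2 * ρ * B.radius W h ⟨e, B.proj α e⟩ := by
      by_contra hcon
      push Not at hcon
      have hne : (B.diffGroups o α).Nonempty := by
        by_contra hemp
        rw [Finset.not_nonempty_iff_eq_empty] at hemp
        rw [gap_eq_sum, hemp, Finset.sum_empty] at hpos
        exact lt_irrefl _ hpos
      have hρ : (0 : ℝ) < ρ := by
        obtain ⟨e, -⟩ := hne
        exact_mod_cast (Nat.zero_le _).trans_lt e.2
      have h1 := Finset.sum_lt_sum_of_nonempty hne hcon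
      rw [← Finset.mul_sum] at h1
      have h2 : ∑ _e ∈ B.diffGroups o α, B.gap o α ≤ ρ * B.gap o α := by
        rw [Finset.sum_const, nsmul_eq_mul]
        gcongr
        exact card_diffGroups_le o α
      have h3 : (ρ : ℝ) * B.gap o α ≤
          ρ * (2 * ∑ e ∈ B.diffGroups o α, B.radius W h ⟨e, B.proj α e⟩) := by gcongr
      linarith
    obtain ⟨e, he, hle⟩ := hex
    have hne := mem_diffGroups.1 he
    refine le_trans ?_ (Finset.single_le_sum (f := fun e => ∑ b ∈ Finset.univ.erase (B.proj o e),
      if B.proj α e = b then truncatedRadius (d e b) (2 * ρ * W) (B.count h ⟨e, b⟩) else 0)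
      (fun _ _ => zero_le) (Finset.mem_univ e))
    refine le_trans ?_ (Finset.single_le_sum
      (f := fun b => if B.proj α e = b then
        truncatedRadius (d e b) (2 * ρ * W) (B.count h ⟨e, b⟩) else 0)
      (fun _ _ => zero_le) (Finset.mem_erase.2 ⟨hne, Finset.mem_univ _⟩))
    rw [if_pos rfl]
    exact ofReal_gap_le_truncatedRadius (hd e hne) hle

/-- At successive pulls of `l` its count runs through `0, 1, 2, …` without repetition. -/
theorem sum_pulls_le {Ω : Type*} {θ : ℕ → Ω → B.Loc → ℝ} {A : ℕ → Ω → B.Joint}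
    {X : ℕ → Ω → Fin ρ → ℝ} (f : ℕ → ENNReal) (ω : Ω) (l : B.Loc) (T : ℕ) :
    ∑ t ∈ Finset.range T, (if B.proj (A t ω) l.1 = l.2 then
      f (B.count (B.hist θ A X t ω) l) else 0) ≤ ∑ n ∈ Finset.range T, f n := by
  have h : ∑ t ∈ Finset.range T, (if B.proj (A t ω) l.1 = l.2 then
      f (B.count (B.hist θ A X t ω) l) else 0) =
      ∑ n ∈ Finset.range (B.count (B.hist θ A X T ω) l), f n := by
    induction T with
    | zero => simp [count_hist_zero]
    | succ T ih =>
      rw [Finset.sum_range_succ, ih, count_hist_succ]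
      split_ifs
      · rw [Finset.sum_range_succ]
      · simp
  rw [h]
  exact Finset.sum_le_sum_of_subset (Finset.range_mono (count_hist_le _ _ _ _))

end MAMAB

/-! ### Measurability, and the cost of blocking through optimism -/

namespace MAMAB

variable {m ρ : ℕ} {B : MAMAB m ρ}

/-- The empirical means are close to the means, with a smaller radius for the local arms
of `o`. -/
structure GoodHistory (σ L τ : ℝ) (o : B.Joint) {t : ℕ} (h : Fin t → B.Round) : Prop where
  all : ∀ l : B.Loc, |B.empMean h l - B.localMean l.1 l.2| ≤
    confidence σ * Real.sqrt (3 * L / ((B.count h l : ℝ) + 1))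
  opt : ∀ e : Fin ρ, |B.empMean h ⟨e, B.proj o e⟩ - B.localMean e (B.proj o e)| ≤
    confidence σ * Real.sqrt (3 * τ / ((B.count h ⟨e, B.proj o e⟩ : ℝ) + 1))

theorem measurable_abs_empMean_sub {t : ℕ} (l : B.Loc) :
    Measurable fun h : Fin t → B.Round => |B.empMean h l - B.localMean l.1 l.2| :=
  continuous_abs.measurable.comp ((B.measurable_empMean l).sub_const _)

theorem measurable_confidence_radius {t : ℕ} (l : B.Loc) (k r : ℝ) :
    Measurable fun h : Fin t → B.Round => k * Real.sqrt (r / ((B.count h l : ℝ) + 1)) :=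
  (Real.continuous_sqrt.measurable.comp
    (measurable_const.div ((measurable_count_real l).add_const 1))).const_mul k

theorem measurableSet_goodHistory (σ L τ : ℝ) (o : B.Joint) (t : ℕ) :
    MeasurableSet {h : Fin t → B.Round | GoodHistory σ L τ o h} := by
  have : {h : Fin t → B.Round | GoodHistory σ L τ o h} =
      {h | (∀ l : B.Loc, |B.empMean h l - B.localMean l.1 l.2| ≤
        confidence σ * Real.sqrt (3 * L / ((B.count h l : ℝ) + 1))) ∧
      ∀ e : Fin ρ, |B.empMean h ⟨e, B.proj o e⟩ - B.localMean e (B.proj o e)| ≤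
        confidence σ * Real.sqrt (3 * τ / ((B.count h ⟨e, B.proj o e⟩ : ℝ) + 1))} := by
    ext h
    exact ⟨fun H => ⟨H.1, H.2⟩, fun H => ⟨H.1, H.2⟩⟩
  rw [this]
  refine measurableSet_setOfPred.2 (Measurable.and (Measurable.forall fun l => ?_)
    (Measurable.forall fun e => ?_))
  · exact measurableSet_setOfPred.1 (measurableSet_le (measurable_abs_empMean_sub l)
      (measurable_confidence_radius l _ _))
  · exact measurableSet_setOfPred.1 (measurableSet_le (measurable_abs_empMean_sub ⟨e, B.proj o e⟩)
      (measurable_confidence_radius ⟨e, B.proj o e⟩ _ _))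

theorem measurable_radius (W : ℝ) {t : ℕ} (l : B.Loc) :
    Measurable fun h : Fin t → B.Round => B.radius W h l :=
  measurable_const.div (Real.continuous_sqrt.measurable.comp
    ((measurable_count_real l).add_const 1))

theorem measurable_value (a : B.Joint) : Measurable fun x : B.Loc → ℝ => B.value x a :=
  Finset.measurable_fun_sum _ fun _ _ => measurable_pi_apply _

theorem measurableSet_blocks (W δ : ℝ) (o : B.Joint) (V : Finset (Fin ρ)) (t : ℕ) (a : B.Joint) :
    MeasurableSet {p : (Fin t → B.Round) × (B.Loc → ℝ) | B.Blocks W δ o V p.1 p.2 a} := by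
  classical
  have : {p : (Fin t → B.Round) × (B.Loc → ℝ) | B.Blocks W δ o V p.1 p.2 a} =
      {p | δ ≤ B.gap o a ∧ B.WellSampled W o p.1 a ∧
        (∀ e, e ∈ V ↔ e ∈ B.diffGroups o a ∧
          B.gap o a ≤ 4 * ρ * B.radius W p.1 ⟨e, B.proj o e⟩) ∧
        (∀ a', (∀ e ∈ V, B.proj a' e ≠ B.proj o e) → B.value p.2 a' ≤ B.value p.2 a) ∧
        (∀ e, e ∈ B.diffGroups o a → p.2 ⟨e, B.proj a e⟩ ≤
          B.localMean e (B.proj a e) + B.radius W p.1 ⟨e, B.proj a e⟩) ∧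
        (∀ e, e ∈ B.diffGroups o a → e ∉ V →
          B.localMean e (B.proj o e) - B.radius W p.1 ⟨e, B.proj o e⟩ ≤
            p.2 ⟨e, B.proj o e⟩)} := by
    ext p
    constructor
    · intro H
      refine ⟨H.1, H.2, fun e => ?_, H.4, H.5, H.6⟩
      rw [← H.3, undersampled, Finset.mem_filter]
    · rintro ⟨h1, h2, h3, h4, h5, h6⟩
      refine ⟨h1, h2, ?_, h4, h5, h6⟩
      ext e
      rw [h3 e, undersampled, Finset.mem_filter]
  rw [this]
  have hr : ∀ l : B.Loc, Measurable fun p : (Fin t → B.Round) × (B.Loc → ℝ) =>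
      B.radius W p.1 l := fun l => (measurable_radius W l).comp measurable_fst
  have hx : ∀ l : B.Loc, Measurable fun p : (Fin t → B.Round) × (B.Loc → ℝ) => p.2 l := fun l =>
    (measurable_pi_apply l).comp measurable_snd
  have hv : ∀ a : B.Joint, Measurable fun p : (Fin t → B.Round) × (B.Loc → ℝ) =>
      B.value p.2 a := fun a => (measurable_value a).comp measurable_snd
  refine measurableSet_setOfPred.2 (measurable_const.and (Measurable.and ?_ (Measurable.and ?_
    (Measurable.and ?_ (Measurable.and ?_ ?_)))))
  · exact measurableSet_setOfPred.1 (measurableSet_lt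
      ((Finset.measurable_fun_sum _ fun e _ => hr _).const_mul 2) measurable_const)
  · refine Measurable.forall fun e => measurable_const.iff (measurable_const.and ?_)
    exact measurableSet_setOfPred.1 (measurableSet_le measurable_const ((hr _).const_mul _))
  · refine Measurable.forall fun a' => measurable_const.imp ?_
    exact measurableSet_setOfPred.1 (measurableSet_le (hv a') (hv a))
  · refine Measurable.forall fun e => measurable_const.imp ?_
    exact measurableSet_setOfPred.1 (measurableSet_le (hx _) ((hr _).const_add _))
  · refine Measurable.forall fun e => measurable_const.imp (measurable_const.imp ?_)
    exact measurableSet_setOfPred.1 (measurableSet_le ((hr _).const_sub _) (hx _))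

theorem measurable_blockedGap (W δ : ℝ) (o : B.Joint) (V : Finset (Fin ρ)) (t : ℕ) :
    Measurable fun p : (Fin t → B.Round) × (B.Loc → ℝ) => B.blockedGap W δ o V p.1 p.2 := by
  classical
  exact Measurable.iSup fun a =>
    Measurable.ite (measurableSet_blocks W δ o V t a) measurable_const measurable_const

/-- The blocked gap after a good history, and zero after a bad one. -/
noncomputable def goodBlockedGap (σ L τ W δ : ℝ) (o : B.Joint) (V : Finset (Fin ρ)) {t : ℕ}
    (p : (Fin t → B.Round) × (B.Loc → ℝ)) : ENNReal :=
  {p : (Fin t → B.Round) × (B.Loc → ℝ) | GoodHistory σ L τ o p.1}.indicator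
    (fun p => B.blockedGap W δ o V p.1 p.2) p

theorem measurable_goodBlockedGap (σ L τ W δ : ℝ) (o : B.Joint) (V : Finset (Fin ρ)) (t : ℕ) :
    Measurable fun p : (Fin t → B.Round) × (B.Loc → ℝ) => goodBlockedGap σ L τ W δ o V p :=
  (measurable_blockedGap W δ o V t).indicator
    (measurable_fst (measurableSet_goodHistory σ L τ o t))

theorem goodBlockedGap_le (σ L τ W δ : ℝ) (o : B.Joint) (V : Finset (Fin ρ)) {t : ℕ}
    (p : (Fin t → B.Round) × (B.Loc → ℝ)) :
    goodBlockedGap σ L τ W δ o V p ≤ B.blockedGap W δ o V p.1 p.2 :=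
  Set.indicator_le_self _ _ _

/-- A lower bound for the probability that the estimate of an optimal local arm is not below its
mean, after a good history. -/
noncomputable def optimism (σ ε : ℝ) : ENNReal :=
  ENNReal.ofReal ε * gaussianReal 0 1 (Set.Ici (confidence σ * Real.sqrt 3))

section Run

variable {Ω : Type*} {θ : ℕ → Ω → B.Loc → ℝ} {A : ℕ → Ω → B.Joint} {X : ℕ → Ω → Fin ρ → ℝ}
  [MeasurableSpace Ω] {P : Measure Ω} [IsProbabilityMeasure P] {c ε : ℝ} {T : ℕ}

/-- The truncated radii of the optimal local arms that are pulled in round `t`. -/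
noncomputable def optimalPulls (W δ : ℝ) (o : B.Joint) (θ : ℕ → Ω → B.Loc → ℝ)
    (A : ℕ → Ω → B.Joint) (X : ℕ → Ω → Fin ρ → ℝ) (t : ℕ) (ω : Ω) : ENNReal :=
  ∑ e : Fin ρ, if B.proj (A t ω) e = B.proj o e then
    truncatedRadius δ (4 * ρ * W) (B.count (B.hist θ A X t ω) ⟨e, B.proj o e⟩) else 0

/-- Conditionally on the history, the blocked gap is independent of the event `U` that the optimal
local arms of `V` are not underestimated. Restricting to `U` therefore loses at most the factor
`optimism ^ |V|`, and on `U` the maximizer pulls an undersampled optimal local arm. The level `τ` of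
`GoodHistory` is the scaling parameter `c`, which makes `optimism` free of `T`. -/
theorem IsRun.pow_mul_lintegral_goodBlockedGap_le (hrun : B.IsRun P c ε T θ A X) (hc : 0 < c)
    (hε : 0 ≤ ε) (hε1 : ε ≤ 1) {σ : ℝ} (L : ℝ) {W δ : ℝ} (hδ : 0 < δ) (o : B.Joint)
    (V : Finset (Fin ρ)) {t : ℕ} (ht : t < T) :
    optimism σ ε ^ V.card * ∫⁻ ω, goodBlockedGap σ L c W δ o V (B.hist θ A X t ω, θ t ω) ∂P ≤
      ∫⁻ ω, optimalPulls W δ o θ A X t ω ∂P := by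
  classical
  let f : (Fin t → B.Round) × (B.Loc → ℝ) → ENNReal := goodBlockedGap σ L c W δ o V
  have hf : Measurable f := measurable_goodBlockedGap σ L c W δ o V t
  let U : Set (B.Loc → ℝ) := {x | ∀ l ∈ B.optimalLocals o V, B.localMean l.1 l.2 ≤ x l}
  have hU : MeasurableSet U := by
    refine measurableSet_setOfPred.2 (Measurable.forall fun l => measurable_const.imp ?_)
    exact measurableSet_setOfPred.1 (measurableSet_le measurable_const (measurable_pi_apply l))
  let g : (Fin t → B.Round) × (B.Loc → ℝ) → ENNReal := fun p =>
    U.indicator (fun x => f (p.1, x)) p.2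
  have hg : Measurable g := by
    have : g = (Prod.snd ⁻¹' U).indicator f := by
      funext p
      by_cases hp : p.2 ∈ U
      · simp [g, hp]
      · simp [g, hp]
    rw [this]
    exact hf.indicator (measurable_snd hU)
  change _ * ∫⁻ ω, f (B.hist θ A X t ω, θ t ω) ∂P ≤ _
  rw [hrun.lintegral_estimate ht hf]
  calc _ ≤ ∫⁻ ω, optimism σ ε ^ V.card * ∫⁻ x, f (B.hist θ A X t ω, x)
          ∂(Measure.pi fun l => B.estimateLaw c ε (B.hist θ A X t ω) l) ∂P :=
        lintegral_const_mul_le _ _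
    _ ≤ ∫⁻ ω, ∫⁻ x, g (B.hist θ A X t ω, x)
          ∂(Measure.pi fun l => B.estimateLaw c ε (B.hist θ A X t ω) l) ∂P := by
        refine lintegral_mono fun ω => ?_
        dsimp only
        set h := B.hist θ A X t ω
        have := fun l => B.isProbabilityMeasure_estimateLaw (c := c) hε hε1 h l
        by_cases hh : GoodHistory σ L c o h
        · rw [← card_optimalLocals o V]
          refine lintegral_le_of_ignores _ _ _ _ (fun l hl => ?_) (fun x => f (h, x))
            (hf.comp measurable_prodMk_left) fun x y hxy => ?_
          · obtain ⟨e, b⟩ := l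
            obtain rfl : b = B.proj o e := (mem_optimalLocals.1 hl).2
            refine B.le_estimateLaw_Ici hc h _ ?_
            have h1 := (abs_le.1 (hh.opt e)).1
            -- The error `confidence σ * √(3c / (n + 1))` is `confidence σ * √3` standard deviations
            -- of the estimate, the threshold in `optimism`.
            rw [mul_assoc, ← Real.sqrt_mul (by norm_num), ← mul_div_assoc]
            linarith
          · have e1 : ∀ x, f (h, x) = B.blockedGap W δ o V h x := fun x =>
              Set.indicator_of_mem (s := {p : (Fin t → B.Round) × (B.Loc → ℝ) |
                GoodHistory σ L c o p.1}) hh _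
            rw [e1, e1]
            exact blockedGap_of_agree hxy
        · have e1 : ∀ x, f (h, x) = 0 := fun x =>
            Set.indicator_of_notMem (s := {p : (Fin t → B.Round) × (B.Loc → ℝ) |
                GoodHistory σ L c o p.1}) hh _
          simp [e1]
    _ = ∫⁻ ω, g (B.hist θ A X t ω, θ t ω) ∂P := (hrun.lintegral_estimate ht hg).symm
    _ ≤ _ := by
        refine lintegral_mono_ae ?_
        filter_upwards [hrun.argmax t ht] with ω hω
        by_cases hx : θ t ω ∈ U
        · have : g (B.hist θ A X t ω, θ t ω) = f (B.hist θ A X t ω, θ t ω) :=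
            Set.indicator_of_mem hx _
          rw [this]
          refine (goodBlockedGap_le _ _ _ _ _ _ _ _).trans (blockedGap_le_of_argmax hδ ?_ hω)
          exact fun e he => hx ⟨e, B.proj o e⟩ (mem_optimalLocals.2 ⟨he, rfl⟩)
        · have : g (B.hist θ A X t ω, θ t ω) = 0 := Set.indicator_of_notMem hx _
          rw [this]
          exact zero_le

theorem IsRun.measurable_truncatedRadius (hrun : B.IsRun P c ε T θ A X) {t : ℕ} (ht : t < T)
    (l : B.Loc) (d Q : ℝ) : Measurable fun ω => if B.proj (A t ω) l.1 = l.2 then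
      truncatedRadius d Q (B.count (B.hist θ A X t ω) l) else 0 := by
  refine Measurable.ite ?_ ?_ measurable_const
  · exact hrun.measurable_arm t ht
      (show MeasurableSet {a : B.Joint | B.proj a l.1 = l.2} from .of_discrete)
  · exact (measurable_from_top (f := truncatedRadius d Q)).comp
      ((B.measurable_count l).comp (hrun.measurable_hist ht.le))

theorem IsRun.sum_lintegral_pulls_le (hrun : B.IsRun P c ε T θ A X) (l : B.Loc) {d Q : ℝ}
    (hd : 0 < d) (hQ : 0 ≤ Q) :
    ∑ t ∈ Finset.range T, ∫⁻ ω, (if B.proj (A t ω) l.1 = l.2 then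
      truncatedRadius d Q (B.count (B.hist θ A X t ω) l) else 0) ∂P ≤
      ENNReal.ofReal (2 * Q ^ 2 / d) := by
  rw [← lintegral_finsetSum _ fun t ht =>
    hrun.measurable_truncatedRadius (Finset.mem_range.1 ht) l d Q]
  calc _ ≤ ∫⁻ ω, ENNReal.ofReal (2 * Q ^ 2 / d) ∂P := lintegral_mono fun ω =>
        (sum_pulls_le _ ω l T).trans (sum_truncatedRadius_le hd hQ T)
    _ = _ := by simp

theorem IsRun.sum_lintegral_optimalPulls_le (hrun : B.IsRun P c ε T θ A X) (o : B.Joint)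
    {W δ : ℝ} (hW : 0 ≤ W) (hδ : 0 < δ) :
    ∑ t ∈ Finset.range T, ∫⁻ ω, optimalPulls W δ o θ A X t ω ∂P ≤
      ρ * ENNReal.ofReal (2 * (4 * ρ * W) ^ 2 / δ) := by
  have h : ∀ t ∈ Finset.range T, ∫⁻ ω, optimalPulls W δ o θ A X t ω ∂P =
      ∑ e : Fin ρ, ∫⁻ ω, (if B.proj (A t ω) e = B.proj o e then
        truncatedRadius δ (4 * ρ * W) (B.count (B.hist θ A X t ω) ⟨e, B.proj o e⟩) else 0) ∂P :=
    fun t ht => lintegral_finsetSum _ fun e _ =>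
      hrun.measurable_truncatedRadius (Finset.mem_range.1 ht) ⟨e, B.proj o e⟩ _ _
  rw [Finset.sum_congr rfl h, Finset.sum_comm]
  calc _ ≤ ∑ e : Fin ρ, ENNReal.ofReal (2 * (4 * ρ * W) ^ 2 / δ) :=
        Finset.sum_le_sum fun e _ =>
          hrun.sum_lintegral_pulls_le ⟨e, B.proj o e⟩ hδ (by positivity)
    _ = _ := by simp

theorem optimism_le_one (σ : ℝ) {ε : ℝ} (hε1 : ε ≤ 1) : optimism σ ε ≤ 1 :=
  mul_le_one' (ENNReal.ofReal_le_one.2 hε1) prob_le_one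

theorem IsRun.pow_mul_sum_goodBlockedGap_le (hrun : B.IsRun P c ε T θ A X) (hc : 0 < c)
    (hε : 0 ≤ ε) (hε1 : ε ≤ 1) {σ : ℝ} (L : ℝ) {W δ : ℝ} (hW : 0 ≤ W) (hδ : 0 < δ)
    (o : B.Joint) :
    optimism σ ε ^ ρ * ∑ t ∈ Finset.range T, ∑ V : Finset (Fin ρ),
        ∫⁻ ω, goodBlockedGap σ L c W δ o V (B.hist θ A X t ω, θ t ω) ∂P ≤
      2 ^ ρ * (ρ * ENNReal.ofReal (2 * (4 * ρ * W) ^ 2 / δ)) := by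
  rw [Finset.sum_comm, Finset.mul_sum]
  calc _ ≤ ∑ V : Finset (Fin ρ), (ρ : ENNReal) * ENNReal.ofReal (2 * (4 * ρ * W) ^ 2 / δ) := by
        refine Finset.sum_le_sum fun V _ => ?_
        rw [Finset.mul_sum]
        refine le_trans (Finset.sum_le_sum fun t ht => ?_)
          (hrun.sum_lintegral_optimalPulls_le o hW hδ)
        refine le_trans (mul_le_mul_left ?_ _)
          (hrun.pow_mul_lintegral_goodBlockedGap_le hc hε hε1 L hδ o V (Finset.mem_range.1 ht))
        -- Passing from `|V|` to `ρ` makes the bound uniform over the `2 ^ ρ` sets `V`.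
        exact pow_le_pow_of_le_one zero_le (optimism_le_one σ hε1)
          ((Finset.card_le_univ V).trans_eq (Fintype.card_fin ρ))
    _ = _ := by simp

end Run

end MAMAB

/-! ### Probability of bad rounds and the expected gap of one round -/

namespace MAMAB

variable {m ρ : ℕ} {B : MAMAB m ρ}

theorem le_Aloc (B : MAMAB m ρ) : ρ ≤ B.Aloc := by
  have : ∀ e : Fin ρ, 1 ≤ Fintype.card (B.LocalArm e) := fun e =>
    Fintype.card_pos_iff.2 ⟨B.proj (Classical.arbitrary B.Joint) e⟩
  calc ρ = ∑ _e : Fin ρ, 1 := by simp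
    _ ≤ _ := Finset.sum_le_sum fun e _ => this e

theorem gap_le_gapMax (o a : B.Joint) : B.gap o a ≤ B.gapMax o :=
  le_ciSup (Set.finite_range _).bddAbove a

theorem gap_self (o : B.Joint) : B.gap o o = 0 := sub_self _

theorem gapMax_nonneg (o : B.Joint) : 0 ≤ B.gapMax o :=
  (gap_self o).symm.le.trans (gap_le_gapMax o o)

theorem gapMax_le {σ : ℝ} (hσ : 0 < σ) (hB : B.Subgaussian σ) (o : B.Joint) :
    B.gapMax o ≤ 6 * σ * ρ := by
  have hmean : ∀ a, |B.mean a| ≤ 3 * σ * ρ := fun a => by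
    calc |B.mean a| ≤ ∑ e : Fin ρ, |B.localMean e (B.proj a e)| := Finset.abs_sum_le_sum_abs _ _
      _ ≤ ∑ _e : Fin ρ, 3 * σ := Finset.sum_le_sum fun e _ => abs_localMean_le hσ hB e _
      _ = _ := by simp [mul_comm]
  refine ciSup_le fun a => ?_
  have h1 := (abs_le.1 (hmean o)).2
  have h2 := (abs_le.1 (hmean a)).1
  unfold gap
  linarith

/-- The constant in the radius of the estimates. -/
noncomputable def radiusConst (σ : ℝ) : ℝ := 3 + 3 * confidence σ

/-- Since `3L ≥ 1` and `τ ≤ L`, both `√(3L)` and `√(6τL)` are at most `3L`, so one radius linear in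
`L` covers both errors. -/
theorem abs_sub_le_radius {σ L τ : ℝ} (hσ : 0 < σ) (hL : 1 / 3 ≤ L) (hτL : τ ≤ L) {o : B.Joint}
    {t : ℕ} {h : Fin t → B.Round} (hh : GoodHistory σ L τ o h) {x : B.Loc → ℝ} {l : B.Loc}
    (hx : |x l - B.empMean h l| ≤
      Real.sqrt (2 * (τ / ((B.count h l : ℝ) + 1)) * (3 * L))) :
    |x l - B.localMean l.1 l.2| ≤ B.radius (radiusConst σ * L) h l := by
  have hk := confidence_pos hσ
  set n : ℝ := (B.count h l : ℝ) with hn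
  have hn0 : 0 ≤ n := by positivity
  have h1 : Real.sqrt (3 * L / (n + 1)) ≤ 3 * L / Real.sqrt (n + 1) := by
    rw [Real.sqrt_div (by linarith)]
    gcongr
    rw [Real.sqrt_le_left (by linarith)]
    nlinarith
  have h2 : Real.sqrt (2 * (τ / (n + 1)) * (3 * L)) ≤ 3 * L / Real.sqrt (n + 1) := by
    have : 2 * (τ / (n + 1)) * (3 * L) ≤ (3 * L) ^ 2 / (n + 1) := by
      rw [show 2 * (τ / (n + 1)) * (3 * L) = 6 * τ * L / (n + 1) by ring]
      gcongr
      nlinarith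
    refine (Real.sqrt_le_sqrt this).trans_eq ?_
    rw [Real.sqrt_div (by positivity), Real.sqrt_sq (by linarith)]
  calc |x l - B.localMean l.1 l.2|
      ≤ |x l - B.empMean h l| + |B.empMean h l - B.localMean l.1 l.2| := abs_sub_le _ _ _
    _ ≤ 3 * L / Real.sqrt (n + 1) + confidence σ * (3 * L / Real.sqrt (n + 1)) :=
        add_le_add (hx.trans h2) ((hh.all l).trans (mul_le_mul_of_nonneg_left h1 hk.le))
    _ = _ := by unfold radius radiusConst; rw [← hn]; ring

section Run

variable {Ω : Type*} {θ : ℕ → Ω → B.Loc → ℝ} {A : ℕ → Ω → B.Joint} {X : ℕ → Ω → Fin ρ → ℝ}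
  [MeasurableSpace Ω] {P : Measure Ω} [IsProbabilityMeasure P] {c ε : ℝ} {T : ℕ}

theorem exp_neg_three_mul_log {x : ℝ} (hx : 0 < x) :
    Real.exp (-(3 * Real.log x)) = (x ^ 3)⁻¹ := by
  have h : 3 * Real.log x = Real.log (x ^ 3) := by rw [Real.log_pow]; norm_num
  rw [Real.exp_neg, h, Real.exp_log (by positivity)]

theorem one_le_three_mul_log {x : ℝ} (hx : 2 ≤ x) : 1 ≤ 3 * Real.log x := by
  have h1 : Real.log 2 ≤ Real.log x := Real.log_le_log (by norm_num) hx
  have h2 := Real.log_two_gt_d9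
  linarith

/-- Two union bounds. All local arms are controlled at level `log (T * Aloc)`, which pays for their
number. The `ρ` optimal ones are also controlled at the smaller level `log T` required by optimism,
and there `ρ ≤ T` pays for the union. -/
theorem IsRun.measure_not_goodHistory_le (hrun : B.IsRun P c ε T θ A X) {σ : ℝ} (hσ : 0 < σ)
    (hB : B.Subgaussian σ) (hρ : 1 ≤ ρ) (hρT : ρ ≤ T) (hT : 2 ≤ T) (o : B.Joint) {t : ℕ}
    (ht : t < T) :
    P {ω | ¬ GoodHistory σ (Real.log (T * B.Aloc)) (Real.log T) o (B.hist θ A X t ω)} ≤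
      ENNReal.ofReal (4 / T) := by
  have hT' : (2 : ℝ) ≤ T := by exact_mod_cast hT
  have hA : (1 : ℝ) ≤ B.Aloc := by exact_mod_cast hρ.trans (le_Aloc B)
  have hTA : (2 : ℝ) ≤ T * B.Aloc := by nlinarith
  let F : ℝ → B.Loc → Set Ω := fun r l =>
    {ω | confidence σ * Real.sqrt (3 * Real.log r / ((B.count (B.hist θ A X t ω) l : ℝ) + 1)) <
        |B.empMean (B.hist θ A X t ω) l - B.localMean l.1 l.2|}
  have hF : ∀ r : ℝ, 2 ≤ r → ∀ l, P (F r l) ≤ ENNReal.ofReal (T * (2 * (r ^ 3)⁻¹)) := by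
    intro r hr l
    have := hrun.measure_empMean_le hσ hB l (one_le_three_mul_log hr) ht.le
    rwa [exp_neg_three_mul_log (by linarith)] at this
  have hsub : {ω | ¬ GoodHistory σ (Real.log (T * B.Aloc)) (Real.log T) o (B.hist θ A X t ω)} ⊆
      (⋃ l : B.Loc, F (T * B.Aloc) l) ∪ ⋃ e : Fin ρ, F T ⟨e, B.proj o e⟩ := by
    intro ω hω
    by_contra hcon
    simp only [Set.mem_union, Set.mem_iUnion, not_or, not_exists] at hcon
    exact hω ⟨fun l => not_lt.1 (hcon.1 l), fun e => not_lt.1 (hcon.2 e)⟩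
  refine (measure_mono hsub).trans ((measure_union_le _ _).trans ?_)
  have h1 : P (⋃ l : B.Loc, F (T * B.Aloc) l) ≤ ENNReal.ofReal (2 / T) := by
    calc _ ≤ ∑ l : B.Loc, P (F (T * B.Aloc) l) := measure_iUnion_fintype_le _ _
      _ ≤ ∑ l : B.Loc, ENNReal.ofReal (T * (2 * ((T * B.Aloc : ℝ) ^ 3)⁻¹)) :=
          Finset.sum_le_sum fun l _ => hF _ hTA l
      _ = ENNReal.ofReal (B.Aloc * (T * (2 * ((T * B.Aloc : ℝ) ^ 3)⁻¹))) := by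
          rw [ENNReal.ofReal_mul (p := (B.Aloc : ℝ)) (by positivity), ENNReal.ofReal_natCast,
            Finset.sum_const, Finset.card_univ, card_loc, nsmul_eq_mul]
      _ ≤ _ := by
          refine ENNReal.ofReal_le_ofReal ?_
          rw [show (B.Aloc : ℝ) * (T * (2 * ((T * B.Aloc : ℝ) ^ 3)⁻¹)) =
            2 / (T * (T * B.Aloc ^ 2)) by field_simp]
          gcongr
          have : (1 : ℝ) ≤ T * B.Aloc ^ 2 := by nlinarith
          nlinarith
  have h2 : P (⋃ e : Fin ρ, F T ⟨e, B.proj o e⟩) ≤ ENNReal.ofReal (2 / T) := by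
    calc _ ≤ ∑ e : Fin ρ, P (F T ⟨e, B.proj o e⟩) := measure_iUnion_fintype_le _ _
      _ ≤ ∑ e : Fin ρ, ENNReal.ofReal (T * (2 * ((T : ℝ) ^ 3)⁻¹)) :=
          Finset.sum_le_sum fun e _ => hF _ hT' _
      _ = ENNReal.ofReal (ρ * (T * (2 * ((T : ℝ) ^ 3)⁻¹))) := by
          rw [ENNReal.ofReal_mul (p := (ρ : ℝ)) (by positivity), ENNReal.ofReal_natCast,
            Finset.sum_const, Finset.card_univ, Fintype.card_fin, nsmul_eq_mul]
      _ ≤ ENNReal.ofReal (T * (T * (2 * ((T : ℝ) ^ 3)⁻¹))) := by gcongr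
      _ = _ := by congr 1; field_simp
  refine (add_le_add h1 h2).trans_eq ?_
  rw [← ENNReal.ofReal_add (by positivity) (by positivity)]
  congr 1
  ring

/-- The event that some estimate is far from the empirical mean. -/
def farEstimate (L τ : ℝ) (θ : ℕ → Ω → B.Loc → ℝ) (A : ℕ → Ω → B.Joint)
    (X : ℕ → Ω → Fin ρ → ℝ) (t : ℕ) : Set Ω :=
  ⋃ l : B.Loc, {ω | Real.sqrt (2 * (τ / ((B.count (B.hist θ A X t ω) l : ℝ) + 1)) * (3 * L)) <
    |θ t ω l - B.empMean (B.hist θ A X t ω) l|}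

theorem IsRun.measurableSet_farEstimate (hrun : B.IsRun P c ε T θ A X) (L τ : ℝ) {t : ℕ}
    (ht : t < T) : MeasurableSet (farEstimate L τ θ A X t) := by
  refine MeasurableSet.iUnion fun l => ?_
  have h1 := (measurable_count_real (B := B) (t := t) l).comp (hrun.measurable_hist ht.le)
  have h2 := (B.measurable_empMean (t := t) l).comp (hrun.measurable_hist ht.le)
  have h3 := (measurable_pi_apply l).comp (hrun.measurable_estimate t ht)
  exact measurableSet_lt (Real.continuous_sqrt.measurable.comp
    (((measurable_const.div (h1.add_const 1)).const_mul 2).mul_const _))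
    (continuous_abs.measurable.comp (h3.sub h2))

theorem IsRun.measure_farEstimate_le (hrun : B.IsRun P c ε T θ A X) (hc : 0 ≤ c) (hε : 0 ≤ ε)
    (hε1 : ε ≤ 1) (hρ : 1 ≤ ρ) (hT : 2 ≤ T) {t : ℕ} (ht : t < T) :
    P (farEstimate (Real.log (T * B.Aloc)) c θ A X t) ≤ ENNReal.ofReal (2 / T) := by
  have hT' : (2 : ℝ) ≤ T := by exact_mod_cast hT
  have hA : (1 : ℝ) ≤ B.Aloc := by exact_mod_cast hρ.trans (le_Aloc B)
  have hTA : (2 : ℝ) ≤ T * B.Aloc := by nlinarith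
  calc _ ≤ ∑ l : B.Loc, _ := measure_iUnion_fintype_le _ _
    _ ≤ ∑ l : B.Loc, ENNReal.ofReal (2 * ((T * B.Aloc : ℝ) ^ 3)⁻¹) := by
        refine Finset.sum_le_sum fun l _ => ?_
        rw [← exp_neg_three_mul_log (by linarith)]
        exact hrun.measure_estimate_le hc hε hε1 l
          (by linarith [one_le_three_mul_log hTA]) ht
    _ = ENNReal.ofReal (B.Aloc * (2 * ((T * B.Aloc : ℝ) ^ 3)⁻¹)) := by
        rw [ENNReal.ofReal_mul (p := (B.Aloc : ℝ)) (by positivity), ENNReal.ofReal_natCast,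
          Finset.sum_const, Finset.card_univ, card_loc, nsmul_eq_mul]
    _ ≤ _ := by
        refine ENNReal.ofReal_le_ofReal ?_
        rw [show (B.Aloc : ℝ) * (2 * ((T * B.Aloc : ℝ) ^ 3)⁻¹) =
          2 / (T * (T ^ 2 * B.Aloc ^ 2)) by field_simp]
        gcongr
        have h1 : (1 : ℝ) ≤ T ^ 2 := by nlinarith
        have h2 : (1 : ℝ) ≤ B.Aloc ^ 2 := by nlinarith
        have : (1 : ℝ) ≤ T ^ 2 * B.Aloc ^ 2 := by nlinarith
        nlinarith

open Classical in
/-- The gap of `a` if it is at least `δ`, and zero otherwise. -/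
noncomputable def truncatedGap (δ : ℝ) (o a : B.Joint) : ℝ :=
  if δ ≤ B.gap o a then B.gap o a else 0

theorem truncatedGap_nonneg {δ : ℝ} (hδ : 0 ≤ δ) (o a : B.Joint) : 0 ≤ truncatedGap δ o a := by
  unfold truncatedGap
  split_ifs with h
  · exact hδ.trans h
  · exact le_rfl

theorem truncatedGap_le_gapMax (δ : ℝ) (o a : B.Joint) : truncatedGap δ o a ≤ B.gapMax o := by
  unfold truncatedGap
  split_ifs
  · exact gap_le_gapMax o a
  · exact gapMax_nonneg o

theorem IsRun.lintegral_truncatedGap_le (hrun : B.IsRun P (Real.log T) ε T θ A X) {σ : ℝ}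
    (hσ : 0 < σ) (hB : B.Subgaussian σ) (hε : 0 ≤ ε) (hε1 : ε ≤ 1) (hρ : 1 ≤ ρ) (hρT : ρ ≤ T)
    (hT : 2 ≤ T) (o : B.Joint) {δ : ℝ} (hδ : 0 < δ) {d : (e : Fin ρ) → B.LocalArm e → ℝ}
    (hd : ∀ a e, δ ≤ B.gap o a → B.proj a e ≠ B.proj o e → d e (B.proj a e) ≤ B.gap o a)
    {L W : ℝ} (hL : L = Real.log (T * B.Aloc)) (hW : W = radiusConst σ * L)
    {t : ℕ} (ht : t < T) :
    ∫⁻ ω, ENNReal.ofReal (truncatedGap δ o (A t ω)) ∂P ≤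
      ENNReal.ofReal (B.gapMax o) * ENNReal.ofReal (6 / T) +
      ((∑ e : Fin ρ, ∑ b ∈ Finset.univ.erase (B.proj o e), ∫⁻ ω, (if B.proj (A t ω) e = b then
        truncatedRadius (d e b) (2 * ρ * W) (B.count (B.hist θ A X t ω) ⟨e, b⟩) else 0) ∂P) +
      ∑ V : Finset (Fin ρ), ∫⁻ ω,
        goodBlockedGap σ L (Real.log T) W δ o V (B.hist θ A X t ω, θ t ω) ∂P) := by
  classical
  have hT' : (2 : ℝ) ≤ T := by exact_mod_cast hT
  have hA : (1 : ℝ) ≤ B.Aloc := by exact_mod_cast hρ.trans (le_Aloc B)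
  have hTA : (2 : ℝ) ≤ T * B.Aloc := by nlinarith
  have hL3 : 1 / 3 ≤ L := by have := one_le_three_mul_log hTA; rw [hL]; linarith
  have hτ0 : 0 ≤ Real.log T := Real.log_nonneg (by linarith)
  have hτL : Real.log T ≤ L := by
    rw [hL]; exact Real.log_le_log (by linarith) (by nlinarith)
  let E₁ : Set Ω := {ω | ¬ GoodHistory σ L (Real.log T) o (B.hist θ A X t ω)}
  let E₂ : Set Ω := farEstimate L (Real.log T) θ A X t
  have hE₁ : MeasurableSet E₁ :=
    (hrun.measurable_hist ht.le (measurableSet_goodHistory σ L (Real.log T) o t)).compl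
  have hE₂ : MeasurableSet E₂ := hrun.measurableSet_farEstimate L _ ht
  let G₁ : Ω → ENNReal := fun ω => (E₁ ∪ E₂).indicator (fun _ => ENNReal.ofReal (B.gapMax o)) ω
  let G₂ : Ω → ENNReal := fun ω => ∑ e : Fin ρ, ∑ b ∈ Finset.univ.erase (B.proj o e),
    (if B.proj (A t ω) e = b then
      truncatedRadius (d e b) (2 * ρ * W) (B.count (B.hist θ A X t ω) ⟨e, b⟩) else 0)
  let G₃ : Ω → ENNReal := fun ω => ∑ V : Finset (Fin ρ),
    goodBlockedGap σ L (Real.log T) W δ o V (B.hist θ A X t ω, θ t ω)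
  have hG₁ : Measurable G₁ := measurable_const.indicator (hE₁.union hE₂)
  have hG₂ : Measurable G₂ := Finset.measurable_fun_sum _ fun e _ =>
    Finset.measurable_fun_sum _ fun b _ => hrun.measurable_truncatedRadius ht ⟨e, b⟩ _ _
  have hgb : ∀ V, Measurable fun ω =>
      goodBlockedGap σ L (Real.log T) W δ o V (B.hist θ A X t ω, θ t ω) := fun V =>
    (measurable_goodBlockedGap σ L (Real.log T) W δ o V t).comp
      ((hrun.measurable_hist ht.le).prodMk (hrun.measurable_estimate t ht))
  -- On a bad round the gap is at most `gapMax`; on a good one it is charged to non-optimal pulls or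
  -- to blocking.
  have hpt : ∀ᵐ ω ∂P, ENNReal.ofReal (truncatedGap δ o (A t ω)) ≤ G₁ ω + (G₂ ω + G₃ ω) := by
    filter_upwards [hrun.argmax t ht] with ω hω
    by_cases hbad : ω ∈ E₁ ∪ E₂
    · refine le_add_right ?_
      have : G₁ ω = ENNReal.ofReal (B.gapMax o) := Set.indicator_of_mem hbad _
      rw [this]
      exact ENNReal.ofReal_le_ofReal (truncatedGap_le_gapMax δ o _)
    · refine le_add_left ?_
      rw [Set.mem_union, not_or] at hbad
      have hgood : GoodHistory σ L (Real.log T) o (B.hist θ A X t ω) := not_not.1 hbad.1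
      have hest : ∀ l, |θ t ω l - B.localMean l.1 l.2| ≤ B.radius W (B.hist θ A X t ω) l := by
        intro l
        rw [hW]
        refine abs_sub_le_radius hσ hL3 hτL hgood (not_lt.1 fun hlt => hbad.2 ?_)
        exact Set.mem_iUnion.2 ⟨l, hlt⟩
      have h3 : G₃ ω = ∑ V : Finset (Fin ρ),
          B.blockedGap W δ o V (B.hist θ A X t ω) (θ t ω) :=
        Finset.sum_congr rfl fun V _ => Set.indicator_of_mem
          (s := {p : (Fin t → B.Round) × (B.Loc → ℝ) | GoodHistory σ L (Real.log T) o p.1})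
          hgood _
      rw [h3]
      unfold truncatedGap
      split_ifs with hgap
      · exact ofReal_gap_le_of_argmax hδ hest hω hgap fun e => hd _ e hgap
      · simp
  refine (lintegral_mono_ae hpt).trans ?_
  rw [lintegral_add_left hG₁, lintegral_add_left hG₂]
  refine add_le_add ?_ (add_le_add (le_of_eq ?_) (le_of_eq ?_))
  · simp only [G₁]
    rw [lintegral_indicator_const (hE₁.union hE₂)]
    gcongr
    refine (measure_union_le _ _).trans ?_
    have h1 : P E₁ ≤ ENNReal.ofReal (4 / T) := by
      simp only [E₁, hL]
      exact hrun.measure_not_goodHistory_le hσ hB hρ hρT hT o ht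
    have h2 : P E₂ ≤ ENNReal.ofReal (2 / T) := by
      simp only [E₂, hL]
      exact hrun.measure_farEstimate_le hτ0 hε hε1 hρ hT ht
    refine (add_le_add h1 h2).trans_eq ?_
    rw [← ENNReal.ofReal_add (by positivity) (by positivity)]
    congr 1
    ring
  · simp only [G₂]
    rw [lintegral_finsetSum _ fun e _ => Finset.measurable_fun_sum _ fun b _ =>
      hrun.measurable_truncatedRadius ht ⟨e, b⟩ _ _]
    exact Finset.sum_congr rfl fun e _ => lintegral_finsetSum _ fun b _ =>
      hrun.measurable_truncatedRadius ht ⟨e, b⟩ _ _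
  · exact lintegral_finsetSum _ fun V _ => hgb V

end Run

end MAMAB

/-! ### Summation over the rounds -/

namespace MAMAB

variable {m ρ : ℕ} {B : MAMAB m ρ}

/-- The probability that a standard Gaussian exceeds the confidence level. -/
noncomputable def upperTail (σ : ℝ) : ℝ :=
  (gaussianReal 0 1 (Set.Ici (confidence σ * Real.sqrt 3))).toReal

theorem upperTail_pos (σ : ℝ) : 0 < upperTail σ :=
  ENNReal.toReal_pos (gaussianReal_Ici_pos _).ne' (measure_ne_top _ _)

theorem optimism_eq (σ : ℝ) {ε : ℝ} (hε : 0 ≤ ε) :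
    optimism σ ε = ENNReal.ofReal (ε * upperTail σ) := by
  rw [optimism, upperTail, ENNReal.ofReal_mul hε, ENNReal.ofReal_toReal (measure_ne_top _ _)]

/-- The constant of the gap-dependent bound. -/
noncomputable def regretConst (σ : ℝ) : ℝ :=
  6 + 32 * radiusConst σ ^ 2 + 4 / upperTail σ + 324 * σ ^ 2

theorem six_le_regretConst (σ : ℝ) : 6 ≤ regretConst σ := by
  have := upperTail_pos σ
  have h1 : 0 ≤ 32 * radiusConst σ ^ 2 := by positivity
  have h2 : 0 ≤ 4 / upperTail σ := by positivity
  have h3 : 0 ≤ 324 * σ ^ 2 := by positivity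
  unfold regretConst
  linarith

section Run

variable {Ω : Type*} {θ : ℕ → Ω → B.Loc → ℝ} {A : ℕ → Ω → B.Joint} {X : ℕ → Ω → Fin ρ → ℝ}
  [MeasurableSpace Ω] {P : Measure Ω} [IsProbabilityMeasure P] {c ε : ℝ} {T : ℕ}

theorem IsRun.sum_integral_truncatedGap_le_of_le (hrun : B.IsRun P (Real.log T) ε T θ A X) {σ : ℝ}
    (hσ : 0 < σ) (hB : B.Subgaussian σ) (hε : 0 < ε) (hε1 : ε ≤ 1) (hρ : 1 ≤ ρ) (hρT : ρ ≤ T)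
    (hT : 2 ≤ T) (o : B.Joint) {δ : ℝ} (hδ : 0 < δ) {d : (e : Fin ρ) → B.LocalArm e → ℝ}
    (hd0 : ∀ e b, b ≠ B.proj o e → 0 < d e b)
    (hd : ∀ a e, δ ≤ B.gap o a → B.proj a e ≠ B.proj o e → d e (B.proj a e) ≤ B.gap o a)
    {L W : ℝ} (hL : L = Real.log (T * B.Aloc)) (hW : W = radiusConst σ * L) (hW0 : 0 ≤ W) :
    ∑ t ∈ Finset.range T, ∫ ω, truncatedGap δ o (A t ω) ∂P ≤
      6 * B.gapMax o +
      ((∑ e : Fin ρ, ∑ b ∈ Finset.univ.erase (B.proj o e), 2 * (2 * ρ * W) ^ 2 / d e b) +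
      2 ^ ρ * (ρ * (2 * (4 * ρ * W) ^ 2 / δ)) / (ε * upperTail σ) ^ ρ) := by
  have hT' : (2 : ℝ) ≤ T := by exact_mod_cast hT
  have hp := upperTail_pos σ
  have hgm := gapMax_nonneg o
  have hτ : 0 < Real.log T := Real.log_pos (by linarith)
  have hdd : ∀ e, ∀ b ∈ Finset.univ.erase (B.proj o e), 0 ≤ 2 * (2 * ρ * W) ^ 2 / d e b :=
    fun e b hb => div_nonneg (by positivity) (hd0 e b (Finset.ne_of_mem_erase hb)).le
  have hsum0 : 0 ≤ ∑ e : Fin ρ, ∑ b ∈ Finset.univ.erase (B.proj o e),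
      2 * (2 * ρ * W) ^ 2 / d e b := Finset.sum_nonneg fun e _ => Finset.sum_nonneg (hdd e)
  rw [← ENNReal.ofReal_le_ofReal_iff (by positivity), ENNReal.ofReal_sum_of_nonneg fun t _ =>
    integral_nonneg fun ω => truncatedGap_nonneg hδ.le o _]
  have hconv : ∀ t ∈ Finset.range T, ENNReal.ofReal (∫ ω, truncatedGap δ o (A t ω) ∂P) =
      ∫⁻ ω, ENNReal.ofReal (truncatedGap δ o (A t ω)) ∂P := fun t ht =>
    ofReal_integral_eq_lintegral_ofReal (hrun.integrable_comp_arm (Finset.mem_range.1 ht) _)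
      (Filter.Eventually.of_forall fun ω => truncatedGap_nonneg hδ.le o _)
  rw [Finset.sum_congr rfl hconv]
  refine (Finset.sum_le_sum fun t ht => hrun.lintegral_truncatedGap_le hσ hB hε.le hε1 hρ hρT hT o
    hδ hd hL hW (Finset.mem_range.1 ht)).trans ?_
  rw [Finset.sum_add_distrib, Finset.sum_add_distrib, ENNReal.ofReal_add (by positivity)
    (by positivity), ENNReal.ofReal_add hsum0 (by positivity)]
  refine add_le_add ?_ (add_le_add ?_ ?_)
  · rw [Finset.sum_const, Finset.card_range, nsmul_eq_mul, ← ENNReal.ofReal_mul hgm,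
      ← ENNReal.ofReal_natCast, ← ENNReal.ofReal_mul (by positivity)]
    refine le_of_eq (congrArg _ ?_)
    field_simp
  · rw [Finset.sum_comm, ENNReal.ofReal_sum_of_nonneg fun e _ => Finset.sum_nonneg (hdd e)]
    refine Finset.sum_le_sum fun e _ => ?_
    rw [Finset.sum_comm, ENNReal.ofReal_sum_of_nonneg (hdd e)]
    exact Finset.sum_le_sum fun b hb => hrun.sum_lintegral_pulls_le ⟨e, b⟩
      (hd0 e b (Finset.ne_of_mem_erase hb)) (by positivity)
  -- The optimism factor is positive and finite, so it can be moved to the other side.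
  · have h := hrun.pow_mul_sum_goodBlockedGap_le hτ hε.le hε1 (σ := σ) L hW0 hδ o
    rw [optimism_eq σ hε.le, ← ENNReal.ofReal_pow (by positivity), mul_comm,
      ← ENNReal.le_div_iff_mul_le (by left; simp; positivity) (by simp)] at h
    refine h.trans_eq ?_
    rw [ENNReal.ofReal_div_of_pos (y := (ε * upperTail σ) ^ ρ) (by positivity),
      ENNReal.ofReal_mul (p := 2 ^ ρ) (by positivity),
      ENNReal.ofReal_mul (p := (ρ : ℝ)) (by positivity), ENNReal.ofReal_natCast,
      ENNReal.ofReal_pow (p := 2) (by norm_num), ENNReal.ofReal_ofNat]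

/-- For `ρ ≤ T` the constants are collected. For `ρ > T` concentration is not needed: fewer than `ρ`
rounds are played, and `gapMax ≤ 6σρ` already gives a bound of the required form. -/
theorem IsRun.sum_integral_truncatedGap_le (hrun : B.IsRun P (Real.log T) ε T θ A X) {σ : ℝ}
    (hσ : 0 < σ) (hB : B.Subgaussian σ) (hε : 0 < ε) (hε1 : ε ≤ 1) (hρ : 1 ≤ ρ)
    (hT : 2 ≤ T) (o : B.Joint) {δ : ℝ} (hδ : 0 < δ) {d : (e : Fin ρ) → B.LocalArm e → ℝ}
    (hd0 : ∀ e b, b ≠ B.proj o e → 0 < d e b)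
    (hd : ∀ a e, δ ≤ B.gap o a → B.proj a e ≠ B.proj o e → d e (B.proj a e) ≤ B.gap o a)
    {L : ℝ} (hL : L = Real.log (T * B.Aloc)) :
    ∑ t ∈ Finset.range T, ∫ ω, truncatedGap δ o (A t ω) ∂P ≤
      regretConst σ * (regretConst σ / ε) ^ ρ * (ρ : ℝ) ^ 2 * L ^ 2 / δ +
      regretConst σ * (∑ e : Fin ρ, ∑ b ∈ Finset.univ.erase (B.proj o e),
        (ρ : ℝ) ^ 2 * L ^ 2 / d e b) + regretConst σ * B.gapMax o := by
  have hT' : (2 : ℝ) ≤ T := by exact_mod_cast hT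
  have hA : (1 : ℝ) ≤ B.Aloc := by exact_mod_cast hρ.trans (le_Aloc B)
  have hTA : (2 : ℝ) ≤ T * B.Aloc := by nlinarith
  have hL3 : 1 / 3 ≤ L := by have := one_le_three_mul_log hTA; rw [hL]; linarith
  have hp := upperTail_pos σ
  have hgm := gapMax_nonneg o
  have hk : 0 < radiusConst σ := by
    have := confidence_pos hσ
    unfold radiusConst; positivity
  have hC6 := six_le_regretConst σ
  have hC1 : 32 * radiusConst σ ^ 2 ≤ regretConst σ := by
    have : 0 ≤ 4 / upperTail σ := by positivity
    unfold regretConst; nlinarith [sq_nonneg σ]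
  have hC2 : 4 / upperTail σ ≤ regretConst σ := by
    unfold regretConst; nlinarith [sq_nonneg σ, sq_nonneg (radiusConst σ)]
  have hC3 : 324 * σ ^ 2 ≤ regretConst σ := by
    have : 0 ≤ 4 / upperTail σ := by positivity
    unfold regretConst; nlinarith [sq_nonneg (radiusConst σ)]
  set C := regretConst σ with hC
  have hCε : 2 ≤ C / ε := by rw [le_div_iff₀ hε]; linarith
  have hdd : ∀ e, ∀ b ∈ Finset.univ.erase (B.proj o e), 0 ≤ (ρ : ℝ) ^ 2 * L ^ 2 / d e b :=
    fun e b hb => div_nonneg (by positivity) (hd0 e b (Finset.ne_of_mem_erase hb)).le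
  have hsum0 : 0 ≤ ∑ e : Fin ρ, ∑ b ∈ Finset.univ.erase (B.proj o e),
      (ρ : ℝ) ^ 2 * L ^ 2 / d e b := Finset.sum_nonneg fun e _ => Finset.sum_nonneg (hdd e)
  have hρ2 : (ρ : ℝ) ≤ 2 ^ ρ := by exact_mod_cast Nat.lt_two_pow_self.le
  rcases le_or_gt ρ T with hρT | hρT
  · refine (hrun.sum_integral_truncatedGap_le_of_le hσ hB hε hε1 hρ hρT hT o hδ hd0 hd hL rfl
      (by positivity)).trans ?_
    have h1 : 6 * B.gapMax o ≤ C * B.gapMax o := by gcongr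
    have h2 : ∑ e : Fin ρ, ∑ b ∈ Finset.univ.erase (B.proj o e),
        2 * (2 * ρ * (radiusConst σ * L)) ^ 2 / d e b ≤
        C * ∑ e : Fin ρ, ∑ b ∈ Finset.univ.erase (B.proj o e), (ρ : ℝ) ^ 2 * L ^ 2 / d e b := by
      rw [Finset.mul_sum]
      refine Finset.sum_le_sum fun e _ => ?_
      rw [Finset.mul_sum]
      refine Finset.sum_le_sum fun b hb => ?_
      calc _ = 8 * radiusConst σ ^ 2 * ((ρ : ℝ) ^ 2 * L ^ 2 / d e b) := by ring
        _ ≤ C * ((ρ : ℝ) ^ 2 * L ^ 2 / d e b) := by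
            refine mul_le_mul_of_nonneg_right ?_ (hdd e b hb)
            nlinarith [sq_nonneg (radiusConst σ)]
    have h3 : 2 ^ ρ * (ρ * (2 * (4 * ρ * (radiusConst σ * L)) ^ 2 / δ)) /
        (ε * upperTail σ) ^ ρ ≤ C * (C / ε) ^ ρ * (ρ : ℝ) ^ 2 * L ^ 2 / δ := by
      calc _ = 2 ^ ρ * ρ * (32 * radiusConst σ ^ 2) * ((ρ : ℝ) ^ 2 * L ^ 2 / δ) /
            (ε * upperTail σ) ^ ρ := by ring
        -- The surplus factor `ρ` is absorbed by a second `2 ^ ρ`; this is the 4 in `4 / upperTail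
        -- σ`.
        _ ≤ 2 ^ ρ * 2 ^ ρ * C * ((ρ : ℝ) ^ 2 * L ^ 2 / δ) / (ε * upperTail σ) ^ ρ := by gcongr
        _ = C * (4 / upperTail σ / ε) ^ ρ * ((ρ : ℝ) ^ 2 * L ^ 2 / δ) := by
            rw [← mul_pow, div_div, div_pow, mul_comm ε]
            norm_num
            ring
        _ ≤ C * (C / ε) ^ ρ * ((ρ : ℝ) ^ 2 * L ^ 2 / δ) := by gcongr
        _ = _ := by ring
    linarith
  · have hρT' : (T : ℝ) ≤ ρ := by exact_mod_cast hρT.le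
    have hgm2 := gapMax_le hσ hB o
    -- A nonzero truncated gap lies between `δ` and `gapMax`.
    have hδg : ∀ a, truncatedGap δ o a ≤ B.gapMax o ^ 2 / δ := by
      intro a
      unfold truncatedGap
      split_ifs with h
      · rw [le_div_iff₀ hδ]
        have := gap_le_gapMax o a
        nlinarith
      · positivity
    have h0 : ∑ t ∈ Finset.range T, ∫ ω, truncatedGap δ o (A t ω) ∂P ≤
        ρ * (B.gapMax o ^ 2 / δ) := by
      calc _ ≤ ∑ t ∈ Finset.range T, B.gapMax o ^ 2 / δ := by
            refine Finset.sum_le_sum fun t ht => ?_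
            calc _ ≤ ∫ _ω, B.gapMax o ^ 2 / δ ∂P :=
                  integral_mono (hrun.integrable_comp_arm (Finset.mem_range.1 ht) _)
                    (integrable_const _) fun ω => hδg _
              _ = _ := by simp
        _ = T * (B.gapMax o ^ 2 / δ) := by simp
        _ ≤ _ := by gcongr
    have h1 : (ρ : ℝ) * (B.gapMax o ^ 2 / δ) ≤
        C * (C / ε) ^ ρ * (ρ : ℝ) ^ 2 * L ^ 2 / δ := by
      -- The missing factor `L²` costs 9, whence `324 = 36 · 9`.
      have hL9 : 1 ≤ 9 * L ^ 2 := by nlinarith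
      calc _ ≤ 2 ^ ρ * ((6 * σ * ρ) ^ 2 / δ) := by gcongr
        _ = 36 * σ ^ 2 * 2 ^ ρ * (ρ : ℝ) ^ 2 * 1 / δ := by ring
        _ ≤ 36 * σ ^ 2 * 2 ^ ρ * (ρ : ℝ) ^ 2 * (9 * L ^ 2) / δ := by gcongr
        _ = 324 * σ ^ 2 * 2 ^ ρ * (ρ : ℝ) ^ 2 * L ^ 2 / δ := by ring
        _ ≤ _ := by gcongr
    have h2 : 0 ≤ C * ∑ e : Fin ρ, ∑ b ∈ Finset.univ.erase (B.proj o e),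
        (ρ : ℝ) ^ 2 * L ^ 2 / d e b := mul_nonneg (by linarith) hsum0
    have h3 : 0 ≤ C * B.gapMax o := mul_nonneg (by linarith) hgm
    linarith

/-! ### From truncated gaps to the two regret bounds -/

theorem IsRun.regret_le_mul_gapMax (hrun : B.IsRun P c ε T θ A X) {σ : ℝ} (hσ : 0 < σ)
    (hB : B.Subgaussian σ) (o : B.Joint) : B.regret P o T X ≤ T * B.gapMax o := by
  rw [hrun.regret_eq hσ hB]
  calc _ ≤ ∑ t ∈ Finset.range T, B.gapMax o := by
        refine Finset.sum_le_sum fun t ht => ?_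
        calc _ ≤ ∫ _ω, B.gapMax o ∂P :=
              integral_mono (hrun.integrable_comp_arm (Finset.mem_range.1 ht) _)
                (integrable_const _) fun ω => gap_le_gapMax o _
          _ = _ := by simp
    _ = _ := by simp

theorem IsRun.regret_le_of_gap_le (hrun : B.IsRun P c ε T θ A X) {σ : ℝ} (hσ : 0 < σ)
    (hB : B.Subgaussian σ) (o : B.Joint) {δ k : ℝ}
    (h : ∀ a, B.gap o a ≤ k + truncatedGap δ o a) :
    B.regret P o T X ≤ T * k + ∑ t ∈ Finset.range T, ∫ ω, truncatedGap δ o (A t ω) ∂P := by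
  rw [hrun.regret_eq hσ hB]
  calc _ ≤ ∑ t ∈ Finset.range T, (k + ∫ ω, truncatedGap δ o (A t ω) ∂P) := by
        refine Finset.sum_le_sum fun t ht => ?_
        have hi := hrun.integrable_comp_arm (Finset.mem_range.1 ht) (truncatedGap δ o)
        calc _ ≤ ∫ ω, (k + truncatedGap δ o (A t ω)) ∂P :=
              integral_mono (hrun.integrable_comp_arm (Finset.mem_range.1 ht) _)
                ((integrable_const _).add hi) fun ω => h _
          _ = _ := by rw [integral_add (integrable_const _) hi]; simp
    _ = _ := by rw [Finset.sum_add_distrib]; simp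

/-- Ensures that the infimum in `localGap` is over a nonempty set and is attained. -/
theorem exists_proj_eq (e : Fin ρ) (b : B.LocalArm e) : ∃ a : B.Joint, B.proj a e = b := by
  classical
  refine ⟨fun i => if h : i ∈ B.group e then b ⟨i, h⟩ else ⟨0, B.K_pos i⟩, ?_⟩
  funext i
  simp [proj]

theorem localGap_le (o a : B.Joint) (e : Fin ρ) : B.localGap o e (B.proj a e) ≤ B.gap o a :=
  ciInf_le (f := fun a' : {a' : B.Joint // B.proj a' e = B.proj a e} => B.gap o a')
    (Set.finite_range _).bddBelow ⟨a, rfl⟩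

theorem gap_nonneg {o : B.Joint} (ho : B.IsOptimal o) (a : B.Joint) : 0 ≤ B.gap o a :=
  sub_nonneg.2 (ho a)

theorem localGap_nonneg {o : B.Joint} (ho : B.IsOptimal o) (e : Fin ρ) (b : B.LocalArm e) :
    0 ≤ B.localGap o e b := Real.iInf_nonneg fun _ => gap_nonneg ho _

theorem gapMin_nonneg {o : B.Joint} (ho : B.IsOptimal o) : 0 ≤ B.gapMin o :=
  Real.iInf_nonneg fun _ => gap_nonneg ho _

theorem localGap_pos {o : B.Joint} (huniq : ∀ a, a ≠ o → 0 < B.gap o a) {e : Fin ρ}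
    {b : B.LocalArm e} (hb : b ≠ B.proj o e) : 0 < B.localGap o e b := by
  have : Nonempty {a : B.Joint // B.proj a e = b} := by
    obtain ⟨a, ha⟩ := exists_proj_eq e b
    exact ⟨⟨a, ha⟩⟩
  obtain ⟨⟨a, ha⟩, h⟩ := exists_eq_ciInf_of_finite
    (f := fun a : {a : B.Joint // B.proj a e = b} => B.gap o a)
  rw [localGap, ← h]
  exact huniq a fun hao => hb (by rw [← ha, hao])

theorem gapMin_le {o a : B.Joint} (ha : a ≠ o) : B.gapMin o ≤ B.gap o a :=
  ciInf_le (f := fun a : {a : B.Joint // a ≠ o} => B.gap o a)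
    (Set.finite_range _).bddBelow ⟨a, ha⟩

theorem exists_ne_of_gapMax_pos {o : B.Joint} (h : 0 < B.gapMax o) : ∃ a : B.Joint, a ≠ o := by
  obtain ⟨a, ha⟩ := exists_eq_ciSup_of_finite (f := fun a : B.Joint => B.gap o a)
  refine ⟨a, fun hao => ?_⟩
  rw [gapMax, ← ha, hao, gap_self] at h
  exact lt_irrefl _ h

theorem gapMin_pos {o : B.Joint} (huniq : ∀ a, a ≠ o → 0 < B.gap o a) (h : 0 < B.gapMax o) :
    0 < B.gapMin o := by
  have : Nonempty {a : B.Joint // a ≠ o} := by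
    obtain ⟨a, ha⟩ := exists_ne_of_gapMax_pos h
    exact ⟨⟨a, ha⟩⟩
  obtain ⟨⟨a, ha⟩, h⟩ := exists_eq_ciInf_of_finite
    (f := fun a : {a : B.Joint // a ≠ o} => B.gap o a)
  rw [gapMin, ← h]
  exact huniq a ha

/-- Separates the degenerate cases (all gaps at most zero, one round, no groups), in which minima or
logarithms may be meaningless and the term in `gapMax` suffices. -/
theorem IsRun.regret_le_gapMax_or (hrun : B.IsRun P c ε T θ A X) {σ : ℝ} (hσ : 0 < σ)
    (hB : B.Subgaussian σ) (o : B.Joint) (hT : 1 ≤ T) :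
    B.regret P o T X ≤ B.gapMax o ∨ (2 ≤ T ∧ 1 ≤ ρ ∧ 0 < B.gapMax o) := by
  have h := hrun.regret_le_mul_gapMax hσ hB o
  rcases (gapMax_nonneg o).eq_or_lt with h0 | h0
  · left
    rw [← h0] at h ⊢
    simpa using h
  · rcases hT.eq_or_lt with h1 | h1
    · left
      rw [← h1] at h
      rw [← h1]
      simpa using h
    · refine Or.inr ⟨h1, ?_, h0⟩
      by_contra hρ
      have hρ0 : (ρ : ℝ) = 0 := by exact_mod_cast (show ρ = 0 by omega)
      have := gapMax_le hσ hB o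
      rw [hρ0, mul_zero] at this
      linarith

theorem IsRun.regret_le_gap_dependent (hrun : B.IsRun P (Real.log T) ε T θ A X) {σ : ℝ}
    (hσ : 0 < σ) (hB : B.Subgaussian σ) (hε : 0 < ε) (hε1 : ε ≤ 1) (hT : 1 ≤ T) {o : B.Joint}
    (ho : B.IsOptimal o) (huniq : ∀ a : B.Joint, a ≠ o → 0 < B.gap o a) :
    B.regret P o T X ≤
      regretConst σ * (regretConst σ / ε) ^ ρ * (ρ : ℝ) ^ 2 *
          Real.log ((T : ℝ) * (B.Aloc : ℝ)) ^ 2 / B.gapMin o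
        + regretConst σ * ∑ e : Fin ρ, ∑ b ∈ Finset.univ.erase (B.proj o e),
            (ρ : ℝ) ^ 2 * Real.log ((T : ℝ) * (B.Aloc : ℝ)) ^ 2 / B.localGap o e b
        + regretConst σ * B.gapMax o := by
  have hC6 := six_le_regretConst σ
  have hC0 : 0 ≤ regretConst σ := by linarith
  rcases hrun.regret_le_gapMax_or hσ hB o hT with h | ⟨hT2, hρ, hpos⟩
  · have h1 : B.gapMax o ≤ regretConst σ * B.gapMax o :=
      le_mul_of_one_le_left (gapMax_nonneg o) (by linarith)
    refine (h.trans h1).trans (le_add_of_nonneg_left (add_nonneg ?_ ?_))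
    -- An empty infimum and a quotient by zero both have the value 0, so nonnegativity holds in the
    -- degenerate cases too.
    · exact div_nonneg (by positivity) (gapMin_nonneg ho)
    · exact mul_nonneg hC0 (Finset.sum_nonneg fun e _ => Finset.sum_nonneg fun b _ =>
        div_nonneg (by positivity) (localGap_nonneg ho e b))
  · have h1 := hrun.sum_integral_truncatedGap_le hσ hB hε hε1 hρ hT2 o (gapMin_pos huniq hpos)
      (d := fun e b => B.localGap o e b) (fun e b => localGap_pos huniq)
      (fun a e _ _ => localGap_le o a e) rfl
    have h2 := hrun.regret_le_of_gap_le hσ hB o (δ := B.gapMin o) (k := 0) fun a => by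
      rw [zero_add]
      by_cases hao : a = o
      · rw [hao, gap_self]
        exact truncatedGap_nonneg (gapMin_nonneg ho) _ _
      · rw [truncatedGap, if_pos (gapMin_le hao)]
    rw [mul_zero, zero_add] at h2
    exact h2.trans h1

theorem IsRun.regret_le_gap_free (hrun : B.IsRun P (Real.log T) ε T θ A X) {σ : ℝ}
    (hσ : 0 < σ) (hB : B.Subgaussian σ) (hε : 0 < ε) (hε1 : ε ≤ 1) (hT : 1 ≤ T) (o : B.Joint) :
    B.regret P o T X ≤ (1 + regretConst σ) * B.gapMax o
        + (1 + regretConst σ) * (ρ : ℝ) *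
          Real.sqrt ((((1 + regretConst σ) / ε) ^ ρ + (B.Aloc : ℝ)) * (T : ℝ)
            * Real.log ((T : ℝ) * (B.Aloc : ℝ)) ^ 2) := by
  have hC6 := six_le_regretConst σ
  have hC0 : 0 ≤ regretConst σ := by linarith
  have hgm := gapMax_nonneg o
  rcases hrun.regret_le_gapMax_or hσ hB o hT with h | ⟨hT2, hρ, -⟩
  · have h1 : B.gapMax o ≤ (1 + regretConst σ) * B.gapMax o :=
      le_mul_of_one_le_left hgm (by linarith)
    exact (h.trans h1).trans (le_add_of_nonneg_right (by positivity))
  · have hT' : (2 : ℝ) ≤ T := by exact_mod_cast hT2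
    have hA : (1 : ℝ) ≤ B.Aloc := by exact_mod_cast hρ.trans (le_Aloc B)
    have hTA : (2 : ℝ) ≤ T * B.Aloc := by nlinarith
    set L := Real.log ((T : ℝ) * (B.Aloc : ℝ)) with hL
    have hL0 : 0 < L := Real.log_pos (by linarith)
    set C := regretConst σ with hC
    set S := (C / ε) ^ ρ + (B.Aloc : ℝ) with hS
    have hS0 : 0 < S := by positivity
    set R := Real.sqrt (S * T) with hR
    have hR0 : 0 < R := Real.sqrt_pos.2 (by positivity)
    have hRR : R ^ 2 = S * T := Real.sq_sqrt (by positivity)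
    -- This is `ρ L √(S / T)`, which balances the cost `T δ` of the ignored gaps against `S ρ² L² /
    -- δ`; both equal `ρ L R`.
    set δ := ρ * L * R / T with hδ
    have hδ0 : 0 < δ := by positivity
    have h1 := hrun.sum_integral_truncatedGap_le hσ hB hε hε1 hρ hT2 o hδ0
      (d := fun _ _ => δ) (fun _ _ _ => hδ0) (fun _ _ h _ => h) hL
    have h2 := hrun.regret_le_of_gap_le hσ hB o (δ := δ) (k := δ) fun a => by
      unfold truncatedGap
      split_ifs with hle
      · linarith
      · linarith
    have h3 : ∑ e : Fin ρ, ∑ b ∈ Finset.univ.erase (B.proj o e), (ρ : ℝ) ^ 2 * L ^ 2 / δ ≤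
        B.Aloc * ((ρ : ℝ) ^ 2 * L ^ 2 / δ) := by
      calc _ ≤ ∑ e : Fin ρ, ∑ b : B.LocalArm e, (ρ : ℝ) ^ 2 * L ^ 2 / δ :=
            Finset.sum_le_sum fun e _ => Finset.sum_le_sum_of_subset_of_nonneg
              (Finset.erase_subset _ _) fun _ _ _ => by positivity
        _ = _ := by
            simp only [Finset.sum_const, Finset.card_univ, nsmul_eq_mul, ← Finset.sum_mul]
            rw [Aloc]
            push_cast
            rfl
    have h4 : S * ((ρ : ℝ) ^ 2 * L ^ 2 / δ) = ρ * L * R := by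
      rw [hδ]
      field_simp
      linarith
    have h5 : T * δ = ρ * L * R := by rw [hδ]; field_simp
    have h6 : B.regret P o T X ≤ C * B.gapMax o + (1 + C) * ρ * (R * L) := by
      have h7 := mul_le_mul_of_nonneg_left h3 hC0
      have h8 : C * (C / ε) ^ ρ * (ρ : ℝ) ^ 2 * L ^ 2 / δ +
          C * (B.Aloc * ((ρ : ℝ) ^ 2 * L ^ 2 / δ)) = C * (ρ * L * R) := by
        rw [← h4, hS]; ring
      rw [h5] at h2
      linarith
    refine h6.trans (add_le_add (by gcongr; linarith) ?_)
    refine mul_le_mul_of_nonneg_left ?_ (by positivity)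
    rw [Real.sqrt_mul (by positivity), Real.sqrt_sq hL0.le]
    gcongr
    rw [hR]
    refine Real.sqrt_le_sqrt ?_
    gcongr
    rw [hS]
    gcongr
    linarith

end Run

end MAMAB

theorem theorem1 (σ : ℝ) (hσ : 0 < σ) :
    (∃ C₁ : ℝ, 0 < C₁ ∧
      ∀ (m ρ : ℕ) (B : MAMAB m ρ), B.Subgaussian σ →
      ∀ o : B.Joint, B.IsOptimal o → (∀ a : B.Joint, a ≠ o → 0 < B.gap o a) →
      ∀ (T : ℕ), 1 ≤ T → ∀ ε : ℝ, 0 < ε → ε ≤ 1 →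
      ∀ (Ω : Type*) [MeasurableSpace Ω] (P : Measure Ω) [IsProbabilityMeasure P]
        (θ : ℕ → Ω → B.Loc → ℝ) (A : ℕ → Ω → B.Joint) (X : ℕ → Ω → Fin ρ → ℝ),
      B.IsRun P (Real.log T) ε T θ A X →
      B.regret P o T X ≤
        C₁ * (C₁ / ε) ^ ρ * (ρ : ℝ) ^ 2 * Real.log ((T : ℝ) * (B.Aloc : ℝ)) ^ 2 / B.gapMin o
        + C₁ * ∑ e : Fin ρ, ∑ b ∈ Finset.univ.erase (B.proj o e),
            (ρ : ℝ) ^ 2 * Real.log ((T : ℝ) * (B.Aloc : ℝ)) ^ 2 / B.localGap o e b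
        + C₁ * B.gapMax o) ∧
    (∃ C₂ : ℝ, 0 < C₂ ∧
      ∀ (m ρ : ℕ) (B : MAMAB m ρ), B.Subgaussian σ →
      ∀ o : B.Joint, B.IsOptimal o →
      ∀ (T : ℕ), 1 ≤ T → ∀ ε : ℝ, 0 < ε → ε ≤ 1 →
      ∀ (Ω : Type*) [MeasurableSpace Ω] (P : Measure Ω) [IsProbabilityMeasure P]
        (θ : ℕ → Ω → B.Loc → ℝ) (A : ℕ → Ω → B.Joint) (X : ℕ → Ω → Fin ρ → ℝ),
      B.IsRun P (Real.log T) ε T θ A X →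
      B.regret P o T X ≤
        C₂ * B.gapMax o
        + C₂ * (ρ : ℝ) * Real.sqrt (((C₂ / ε) ^ ρ + (B.Aloc : ℝ)) * (T : ℝ)
            * Real.log ((T : ℝ) * (B.Aloc : ℝ)) ^ 2)) := by
  have hC := MAMAB.six_le_regretConst σ
  -- The additional 1 in the second constant pays for the gaps below the threshold.
  refine ⟨⟨MAMAB.regretConst σ, by linarith, ?_⟩, ⟨1 + MAMAB.regretConst σ, by linarith, ?_⟩⟩
  · intro m ρ B hB o ho huniq T hT ε hε hε1 Ω _ P _ θ A X hrun
    exact hrun.regret_le_gap_dependent hσ hB hε hε1 hT ho huniq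
  · intro m ρ B hB o _ T hT ε hε hε1 Ω _ P _ θ A X hrun
    exact hrun.regret_le_gap_free hσ hB hε hε1 hT o
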